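/- Let $g\ge 0$ and let $\alpha_1,\dots,\alpha_g,\beta_1,\dots,\beta_g$ be real numbers with $-1<\alpha_1\le\beta_1<\alpha_2\le\beta_2<\cdots<\alpha_g\le\beta_g<1$. Put $$E=[-1,\alpha_1]\cup\bigcup_{l=1}^{g-1}[\beta_l,\alpha_{l+1}]\cup[\beta_g,1]$$ (so $E=[-1,1]$ if $g=0$) and $$w(x)=\frac1\pi\sqrt{\frac{\prod_{l=1}^g(x-\alpha_l)}{(1-x^2)\prod_{l=1}^g(x-\beta_l)}}\qquad(x\in E).$$ Let $P_n$ ($n\ge 0$) be the monic polynomial of degree $n$ with $\int_E P_nP_m\,w\,dx=0$ for $n\ne m$, and let $a_n,b_n$ ($n\ge1$) be the coefficients of their recurrence relation $xP_n(x)=P_{n+1}(x)+b_{n+1}P_n(x)+a_nP_{n-1}(x)$ for $n\ge1$, $xP_0(x)=P_1(x)+b_1P_0(x)$. Let $\mathfrak K\ge 1$ be an integer such that the recurrence coefficients have period $\mathfrak K$, that is, $b_{n+\mathfrak K}=b_n$ for all $n\ge1$ and $a_{n+\mathfrak K}=a_n$ for all $n\ge2$. Then for all integers $n,j\ge0$ and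 all $1\le i\le g$: if $P_j$ has a zero in the open gap $(\alpha_i,\beta_i)$, then $P_{n\mathfrak K+j}$ also has a zero in $(\alpha_i,\beta_i)$. -/

import Mathlib

open Polynomial MeasureTheory

noncomputable section

namespace GenCheb

/-- The set `E = [-1, α₁] ∪ [β₁, α₂] ∪ ⋯ ∪ [β_g, 1]`, written as `[-1, 1]` with the gaps
`(αᵢ, βᵢ)` removed. -/
def bands {g : ℕ} (α β : Fin g → ℝ) : Set ℝ :=
  Set.Icc (-1) 1 \ ⋃ i, Set.Ioo (α i) (β i)

/-- The weight `w(x) = (1/π) √(∏ (x - αⱼ) / ((1 - x²) ∏ (x - βⱼ)))`. -/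
def weight {g : ℕ} (α β : Fin g → ℝ) (x : ℝ) : ℝ :=
  1 / Real.pi * Real.sqrt ((∏ i, (x - α i)) / ((1 - x ^ 2) * ∏ i, (x - β i)))

/-- The inner product `∫_E p(x) q(x) w(x) dx` of two real polynomials. -/
def polyInner {g : ℕ} (α β : Fin g → ℝ) (p q : ℝ[X]) : ℝ :=
  ∫ x in bands α β, p.eval x * q.eval x * weight α β x

/-- The monic orthogonal polynomials `Pₙ` on `E` with respect to `w`, by Gram-Schmidt
orthogonalization of `1, X, X², …`. -/
def P {g : ℕ} (α β : Fin g → ℝ) (n : ℕ) : ℝ[X] :=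
  X ^ n - ∑ k : Fin n,
    C (polyInner α β (X ^ n) (P α β k) / polyInner α β (P α β k) (P α β k)) * P α β k
termination_by n
decreasing_by exact k.2

/-- The squared norms `hₙ = ∫_E Pₙ² w`. -/
def h {g : ℕ} (α β : Fin g → ℝ) (n : ℕ) : ℝ :=
  polyInner α β (P α β n) (P α β n)

/-- The coefficient `aₙ = hₙ / hₙ₋₁` (`n ≥ 1`) in the recurrence
`x Pₙ = Pₙ₊₁ + bₙ₊₁ Pₙ + aₙ Pₙ₋₁`. -/
def recA {g : ℕ} (α β : Fin g → ℝ) (n : ℕ) : ℝ :=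
  h α β n / h α β (n - 1)

/-- The coefficient `bₙ = (∫_E x Pₙ₋₁² w) / hₙ₋₁` (`n ≥ 1`) in the recurrence
`x Pₙ = Pₙ₊₁ + bₙ₊₁ Pₙ + aₙ Pₙ₋₁`. -/
def recB {g : ℕ} (α β : Fin g → ℝ) (n : ℕ) : ℝ :=
  polyInner α β (X * P α β (n - 1)) (P α β (n - 1)) / h α β (n - 1)

/-- The recurrence coefficients have period `K`: `bₙ₊K = bₙ` for `n ≥ 1`, and `aₙ₊K = aₙ` for
`n ≥ 2` (the coefficient `a₁` is exceptional and is not part of the period). -/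
def HasPeriod {g : ℕ} (α β : Fin g → ℝ) (K : ℕ) : Prop :=
  (∀ n, 1 ≤ n → recB α β (n + K) = recB α β n) ∧
    (∀ n, 2 ≤ n → recA α β (n + K) = recA α β n)

end GenCheb

end

/-!
Let `F(z) = ∫ w(x) / (z - x) dx`. Then `F² = N / D` with `N = ∏ (z - αₗ)` and
`D = (z² - 1) ∏ (z - βₗ)`. Indeed `π (1 - x) w = √(-r)` on `E`, where `r = (z - 1)² N / D`; by
interlacing, the superlevel sets `{√(-r) > t}` consist of one interval per band, with endpoints the
roots of `r` and `r + t²`, so that `1 / (z - x)` integrates over them to an explicit logarithm, and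
integration over `t` gives `∫ √(-r) / (z - x) dx = π (1 - √r(z))`.

The functions `ψₙ(z) = ∫ Pₙ(x) w(x) / (z - x) dx = F Pₙ - Qₙ`, with polynomials `Qₙ`, solve the
three-term recurrence, and `ψₙ² / hₙ` is summable by Bessel's inequality. When the coefficients are
periodic this decay makes `ψ` a Floquet solution, `ψₙ₊K = l ψₙ` for `n ≥ 1`, with
`l² < A = a₂ ⋯ a_{K+1}`. Equivalently `F` satisfies a quadratic equation with polynomial
coefficients. Since `F² = N / D` and `F` is not rational, its middle coefficient vanishes, so that
`-F` is the other root and `F Pₙ + Qₙ` is also a Floquet solution, with multiplier `A / l`.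

In a gap `(αᵢ, βᵢ)` the Green's function `Pₙ ψₙ` is strictly decreasing, and `F < 0` because `F`
tends to `0` at `αᵢ`. If `Pₙ(y) = 0`, then `Pₙ ψₙ > 0` to the left of `y`, and comparison of the two
multipliers gives `Pₙ₊K ψₙ₊K > 0` there. Near `βᵢ`, where `F` is unbounded, the second solution
forces `Pₙ₊K ψₙ₊K < 0`. As `ψₙ₊K` has no zero in the gap, this sign change is a zero of `Pₙ₊K`.
-/

namespace GenCheb

open Filter Topology Finset

section Recurrence

variable {R : Type*} [CommRing R] {c d u v : ℕ → R} {K : ℕ}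

/-- The module of solutions of the recurrence `u (n + 2) = c n * u (n + 1) - d n * u n`. -/
def recSolutions (c d : ℕ → R) : Submodule R (ℕ → R) where
  carrier := {u | ∀ n, u (n + 2) = c n * u (n + 1) - d n * u n}
  zero_mem' n := by simp
  add_mem' hu hv n := by
    simp only [Pi.add_apply, hu n, hv n]
    ring
  smul_mem' r u hu n := by
    simp only [Pi.smul_apply, smul_eq_mul, hu n]
    ring

lemma eq_of_mem_recSolutions (hu : u ∈ recSolutions c d) (hv : v ∈ recSolutions c d)
    (h0 : u 0 = v 0) (h1 : u 1 = v 1) (n : ℕ) : u n = v n := by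
  induction n using Nat.twoStepInduction with
  | zero => exact h0
  | one => exact h1
  | more n ih ih' => rw [hu n, hv n, ih, ih']

lemma shift_mem_recSolutions (hc : Function.Periodic c K) (hd : Function.Periodic d K)
    (hu : u ∈ recSolutions c d) : (fun n => u (n + K)) ∈ recSolutions c d := fun n => by
  have := hu (n + K)
  rwa [hc, hd, add_right_comm n K, add_right_comm n K] at this

/-- The Casoratian of two sequences, the discrete analogue of the Wronskian. -/
def casoratian (u v : ℕ → R) (n : ℕ) : R :=
  u (n + 1) * v n - u n * v (n + 1)

lemma casoratian_eq_prod_mul (hu : u ∈ recSolutions c d) (hv : v ∈ recSolutions c d) (n : ℕ) :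
    casoratian u v n = (∏ i ∈ range n, d i) * casoratian u v 0 := by
  induction n with
  | zero => simp
  | succ n ih =>
    rw [prod_range_succ, mul_right_comm, ← ih]
    simp only [casoratian, hu n, hv n]
    ring

/-- The Casoratian, at index `1`, of the shift of `u` by `K` and `v`. -/
def shiftCasoratian (K : ℕ) (u v : ℕ → R) : R :=
  u (K + 2) * v 1 - u (K + 1) * v 2

lemma casoratian_shift_tail : casoratian (fun n => u (n + K + 1)) (fun n => v (n + 1)) 0 =
    shiftCasoratian K u v := by
  simp only [casoratian, shiftCasoratian, zero_add, add_comm 1 K]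

/-- `u` is a Floquet sequence of period `K` with multiplier `l`. -/
def IsFloquet (K : ℕ) (l : R) (u : ℕ → R) : Prop :=
  ∀ n, u (n + K) = l * u n

lemma IsFloquet.apply_mul_add {l : R} (h : IsFloquet K l u) (m j : ℕ) :
    u (m * K + j) = l ^ m * u j := by
  induction m with
  | zero => simp
  | succ m ih => rw [add_mul, one_mul, add_right_comm, h, ih, pow_succ', mul_assoc]

lemma IsFloquet.mul_eq_prod [IsDomain R] {l k : R} (hlu : IsFloquet K l u) (hkv : IsFloquet K k v)
    (hu : u ∈ recSolutions c d) (hv : v ∈ recSolutions c d) (h0 : casoratian u v 0 ≠ 0) :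
    l * k = ∏ i ∈ range K, d i := by
  refine mul_right_cancel₀ h0 ?_
  rw [← casoratian_eq_prod_mul hu hv]
  have hu0 := hlu 0
  have hu1 := hlu 1
  have hv0 := hkv 0
  have hv1 := hkv 1
  simp only [zero_add, add_comm 1] at hu0 hu1 hv0 hv1
  simp only [casoratian, zero_add, hu0, hu1, hv0, hv1]
  ring

end Recurrence

lemma exists_isFloquet {F : Type*} [Field F] {c d u : ℕ → F} {K : ℕ}
    (hc : Function.Periodic c K) (hd : Function.Periodic d K) (hu : u ∈ recSolutions c d)
    (h0 : u 0 ≠ 0 ∨ u 1 ≠ 0) (hcas : casoratian (fun n => u (n + K)) u 0 = 0) :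
    ∃ l, IsFloquet K l u := by
  simp only [casoratian, zero_add, add_comm 1 K] at hcas
  suffices h : ∃ l, u K = l * u 0 ∧ u (K + 1) = l * u 1 by
    obtain ⟨l, hl0, hl1⟩ := h
    exact ⟨l, eq_of_mem_recSolutions (shift_mem_recSolutions hc hd hu)
      (Submodule.smul_mem _ l hu) (by simpa using hl0) (by simpa [add_comm 1 K] using hl1)⟩
  by_cases hu0 : u 0 = 0
  · have hu1 : u 1 ≠ 0 := h0.resolve_left (not_not_intro hu0)
    have huK : u K = 0 := by simpa [hu0, hu1] using hcas
    exact ⟨u (K + 1) / u 1, by rw [huK, hu0, mul_zero], by field_simp⟩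
  · exact ⟨u K / u 0, by field_simp, by field_simp; linear_combination hcas⟩

lemma prod_range_mul_add_of_periodic {M : Type*} [CommMonoid M] {d : ℕ → M} {K : ℕ}
    (hd : Function.Periodic d K) (m j : ℕ) :
    ∏ i ∈ range (m * K + j), d i = (∏ i ∈ range K, d i) ^ m * ∏ i ∈ range j, d i := by
  induction m with
  | zero => simp
  | succ m ih =>
    rw [add_mul, one_mul, add_right_comm, add_comm _ K, prod_range_add, pow_succ', mul_assoc, ← ih]
    simp only [add_comm K, hd _]

section Decay

variable {c d u : ℕ → ℝ} {K : ℕ}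

lemma tendsto_div_sqrt_prod_pow (hd : Function.Periodic d K) (hd0 : ∀ n, 0 < d n) (hK : K ≠ 0)
    (hlim : Tendsto (fun n => u n ^ 2 / ∏ i ∈ range n, d i) atTop (𝓝 0)) (j : ℕ) :
    Tendsto (fun m => u (m * K + j) / √(∏ i ∈ range K, d i) ^ m) atTop (𝓝 0) := by
  have hpos : ∀ n, 0 < ∏ i ∈ range n, d i := fun n => prod_pos fun i _ => hd0 i
  have hsub : Tendsto (fun m => m * K + j) atTop atTop :=
    tendsto_atTop_mono (fun m => (Nat.le_mul_of_pos_right m (Nat.pos_of_ne_zero hK)).trans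
      (Nat.le_add_right _ j)) tendsto_id
  have hsq := (hlim.comp hsub).mul_const (∏ i ∈ range j, d i)
  rw [zero_mul] at hsq
  rw [tendsto_zero_iff_abs_tendsto_zero]
  have habs := hsq.sqrt
  rw [Real.sqrt_zero] at habs
  refine habs.congr fun m => ?_
  have hj := (hpos j).ne'
  have hK' := (hpos K).ne'
  rw [Function.comp_apply, Function.comp_apply, ← Real.sqrt_sq_eq_abs, div_pow, ← pow_mul,
    mul_comm m 2, pow_mul, Real.sq_sqrt (hpos K).le, prod_range_mul_add_of_periodic hd]
  congr 1
  field_simp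

lemma casoratian_shift_eq_zero_of_tendsto (hc : Function.Periodic c K) (hd : Function.Periodic d K)
    (hd0 : ∀ n, 0 < d n) (hK : K ≠ 0) (hu : u ∈ recSolutions c d)
    (hlim : Tendsto (fun n => u n ^ 2 / ∏ i ∈ range n, d i) atTop (𝓝 0)) :
    casoratian (fun n => u (n + K)) u 0 = 0 := by
  have hpos : 0 < ∏ i ∈ range K, d i := prod_pos fun i _ => hd0 i
  have hdecay := tendsto_div_sqrt_prod_pow hd hd0 hK hlim
  have hcas := ((hdecay (K + 1)).mul (hdecay 0)).sub ((hdecay K).mul (hdecay 1))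
  rw [mul_zero, sub_zero] at hcas
  refine tendsto_nhds_unique (tendsto_const_nhds.congr fun m => ?_) hcas
  have hsq := Real.mul_self_sqrt hpos.le
  have hcm := casoratian_eq_prod_mul (shift_mem_recSolutions hc hd hu) hu (m * K)
  have hprod := prod_range_mul_add_of_periodic hd m 0
  rw [add_zero, prod_range_zero, mul_one] at hprod
  rw [hprod] at hcm
  have hpow : √(∏ i ∈ range K, d i) ^ m * √(∏ i ∈ range K, d i) ^ m = (∏ i ∈ range K, d i) ^ m := by
    rw [← mul_pow, hsq]
  rw [div_mul_div_comm, div_mul_div_comm, ← sub_div, hpow, eq_div_iff (by positivity), mul_comm,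
    ← hcm, add_zero]
  simp only [casoratian, add_assoc, add_comm 1 K]

lemma IsFloquet.sq_lt_prod {l : ℝ} (hl : IsFloquet K l u) (hd : Function.Periodic d K)
    (hd0 : ∀ n, 0 < d n) (hK : K ≠ 0) (hu0 : u ≠ 0)
    (hlim : Tendsto (fun n => u n ^ 2 / ∏ i ∈ range n, d i) atTop (𝓝 0)) :
    l ^ 2 < ∏ i ∈ range K, d i := by
  have hpos : 0 < ∏ i ∈ range K, d i := prod_pos fun i _ => hd0 i
  obtain ⟨j, hj⟩ := Function.ne_iff.1 hu0
  have hpow : Tendsto (fun m => (l / √(∏ i ∈ range K, d i)) ^ m) atTop (𝓝 0) := by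
    have := (tendsto_div_sqrt_prod_pow hd hd0 hK hlim j).div_const (u j)
    rw [zero_div] at this
    refine this.congr fun m => ?_
    have : u j ≠ 0 := hj
    rw [hl.apply_mul_add, div_pow]
    field_simp
  rw [tendsto_pow_atTop_nhds_zero_iff, abs_div, abs_of_pos (Real.sqrt_pos.2 hpos),
    div_lt_one (Real.sqrt_pos.2 hpos)] at hpow
  rwa [← sq_abs, ← Real.lt_sqrt (abs_nonneg l)]

end Decay

section MomentFunctional

variable {F : Type*} [Field F] {L : F[X] →ₗ[F] F} {P : ℕ → F[X]}

/-- The squared norm `hₙ` of the `n`-th orthogonal polynomial. -/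
noncomputable def sqNorm (L : F[X] →ₗ[F] F) (P : ℕ → F[X]) (n : ℕ) : F :=
  L (P n * P n)

/-- `P` is the sequence of monic orthogonal polynomials of the moment functional `L`. -/
structure IsMonicOrthogonal (L : F[X] →ₗ[F] F) (P : ℕ → F[X]) : Prop where
  monic : ∀ n, (P n).Monic
  natDegree : ∀ n, (P n).natDegree = n
  orthogonal : ∀ m n, m < n → L (P n * P m) = 0
  sqNorm_ne_zero : ∀ n, sqNorm L P n ≠ 0

/-- The off-diagonal Jacobi coefficient `hₙ₊₁ / hₙ`, which is `aₙ₊₁` in the indexing of `recA`. -/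
noncomputable def jacobiA (L : F[X] →ₗ[F] F) (P : ℕ → F[X]) (n : ℕ) : F :=
  sqNorm L P (n + 1) / sqNorm L P n

/-- The diagonal Jacobi coefficient, which is `bₙ₊₁` in the indexing of `recB`. -/
noncomputable def jacobiB (L : F[X] →ₗ[F] F) (P : ℕ → F[X]) (n : ℕ) : F :=
  L (X * P n * P n) / sqNorm L P n

/-- The polynomials of the second kind, normalized so that `Pₙ(z) L(1 / (z - x)) - Qₙ(z)` is
`L(Pₙ(x) / (z - x))`. -/
noncomputable def secondKind (L : F[X] →ₗ[F] F) (P : ℕ → F[X]) : ℕ → F[X]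
  | 0 => 0
  | 1 => C (sqNorm L P 0)
  | n + 2 => (X - C (jacobiB L P (n + 1))) * secondKind L P (n + 1) -
      C (jacobiA L P n) * secondKind L P n

/-- The Jacobi coefficients have period `K ≠ 0`, except that `jacobiA L P 0` is not part of the
period. -/
structure HasPeriodicJacobi (L : F[X] →ₗ[F] F) (P : ℕ → F[X]) (K : ℕ) : Prop where
  ne_zero : K ≠ 0
  periodic_jacobiB : Function.Periodic (jacobiB L P) K
  periodic_jacobiA : Function.Periodic (fun n => jacobiA L P (n + 1)) K

lemma secondKind_mem_recSolutions : secondKind L P ∈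
    recSolutions (fun n => X - C (jacobiB L P (n + 1))) fun n => C (jacobiA L P n) :=
  fun _ => rfl

lemma eval_mem_recSolutions {c d u : ℕ → F[X]} (hu : u ∈ recSolutions c d) (z : F) :
    (fun n => (u n).eval z) ∈ recSolutions (fun n => (c n).eval z) fun n => (d n).eval z :=
  fun n => by simp only [hu n, eval_sub, eval_mul]

lemma degree_sub_lt_of_monic {p q : F[X]} {n : ℕ} (hp : p.Monic) (hq : q.Monic)
    (hpn : p.natDegree = n) (hqn : q.natDegree = n) : (p - q).degree < n := by
  have hp' := degree_eq_natDegree hp.ne_zero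
  have hq' := degree_eq_natDegree hq.ne_zero
  rw [hpn] at hp'
  rw [hqn] at hq'
  rw [← hp']
  exact degree_sub_lt_left (hp'.trans hq'.symm) hp.ne_zero (by rw [hp, hq])

namespace IsMonicOrthogonal

lemma zero_eq_one (H : IsMonicOrthogonal L P) : P 0 = 1 :=
  (H.monic 0).natDegree_eq_zero.1 (H.natDegree 0)

lemma degree_eq (H : IsMonicOrthogonal L P) (n : ℕ) : (P n).degree = n := by
  rw [degree_eq_natDegree (H.monic n).ne_zero, H.natDegree]

lemma map_mul_eq_zero (H : IsMonicOrthogonal L P) {n : ℕ} {q : F[X]} (hq : q.degree < n) :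
    L (P n * q) = 0 := by
  let S : Polynomial.Sequence F := ⟨P, H.degree_eq⟩
  rw [← mem_degreeLT, ← S.span_degreeLT fun i _ => (H.monic i).leadingCoeff ▸ isUnit_one] at hq
  have hle : Submodule.span F (S '' Set.Iio n) ≤ (L ∘ₗ LinearMap.mulLeft F (P n)).ker := by
    rw [Submodule.span_le, Set.image_subset_iff]
    exact fun m hm => H.orthogonal m n hm
  exact hle hq

lemma map_mul_eq_coeff_mul (H : IsMonicOrthogonal L P) {n : ℕ} {q : F[X]} (hq : q.natDegree ≤ n) :
    L (P n * q) = q.coeff n * sqNorm L P n := by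
  have hcoeff : (P n).coeff n = 1 := by simpa [H.natDegree] using (H.monic n).coeff_natDegree
  have hlt : (q - q.coeff n • P n).degree < n := by
    rw [degree_lt_iff_coeff_zero]
    intro m hm
    rcases hm.eq_or_lt with rfl | hm
    · simp [hcoeff]
    · simp [coeff_eq_zero_of_natDegree_lt (hq.trans_lt hm),
        coeff_eq_zero_of_natDegree_lt ((H.natDegree n).trans_lt hm)]
  simpa [mul_sub, sub_eq_zero, sqNorm] using H.map_mul_eq_zero hlt

lemma eq_zero_of_map_mul_eq_zero (H : IsMonicOrthogonal L P) {n : ℕ} {q : F[X]}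
    (hq : q.degree < n) (h : ∀ m < n, L (P m * q) = 0) : q = 0 := by
  by_contra hq0
  have hqn := h q.natDegree ((natDegree_lt_iff_degree_lt hq0).2 hq)
  rw [H.map_mul_eq_coeff_mul le_rfl] at hqn
  exact mul_ne_zero (leadingCoeff_ne_zero.2 hq0) (H.sqNorm_ne_zero _) hqn

lemma map_mul_X_mul_of_lt (H : IsMonicOrthogonal L P) {m n : ℕ} (h : m + 1 < n) :
    L (P m * (X * P n)) = 0 := by
  rw [mul_left_comm, ← mul_assoc, mul_comm]
  refine H.map_mul_eq_zero ?_
  rw [degree_mul, degree_X, H.degree_eq, add_comm]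
  exact_mod_cast h

lemma map_mul_X_mul_succ (H : IsMonicOrthogonal L P) (n : ℕ) :
    L (P n * (X * P (n + 1))) = sqNorm L P (n + 1) := by
  have hdeg : (X * P n).natDegree = n + 1 := by
    rw [natDegree_X_mul (H.monic n).ne_zero, H.natDegree]
  rw [mul_left_comm, ← mul_assoc, mul_comm, H.map_mul_eq_coeff_mul hdeg.le, ← hdeg,
    (monic_X.mul (H.monic n)).coeff_natDegree, one_mul]

lemma map_mul_of_ne (H : IsMonicOrthogonal L P) {m n : ℕ} (h : m ≠ n) : L (P m * P n) = 0 := by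
  rcases h.lt_or_gt with h | h
  · rw [mul_comm, H.orthogonal m n h]
  · exact H.orthogonal n m h

lemma map_sum_smul_mul_self (H : IsMonicOrthogonal L P) (s : Finset ℕ) (c : ℕ → F) :
    L ((∑ m ∈ s, c m • P m) * ∑ m ∈ s, c m • P m) = ∑ m ∈ s, c m ^ 2 * sqNorm L P m := by
  rw [sum_mul, map_sum]
  refine sum_congr rfl fun m hm => ?_
  rw [mul_sum, map_sum, sum_eq_single_of_mem m hm]
  · simp only [smul_mul_smul_comm, map_smul, smul_eq_mul, sqNorm, sq]
  · intro k _ hk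
    rw [smul_mul_smul_comm, map_smul, H.map_mul_of_ne hk.symm, smul_zero]

lemma degree_X_mul_sub_succ_lt (H : IsMonicOrthogonal L P) (n : ℕ) :
    (X * P n - P (n + 1)).degree < ((n + 1 : ℕ) : WithBot ℕ) :=
  degree_sub_lt_of_monic (monic_X.mul (H.monic n)) (H.monic _)
    (by rw [natDegree_X_mul (H.monic n).ne_zero, H.natDegree]) (H.natDegree _)

lemma one_eq (H : IsMonicOrthogonal L P) : P 1 = X - C (jacobiB L P 0) := by
  suffices h : X * P 0 - P 1 - jacobiB L P 0 • P 0 = 0 by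
    rw [H.zero_eq_one, smul_eq_C_mul] at h
    linear_combination -h
  refine H.eq_zero_of_map_mul_eq_zero (n := 1) ?_ fun m hm => ?_
  · refine (degree_sub_le _ _).trans_lt (max_lt (H.degree_X_mul_sub_succ_lt 0) ?_)
    exact (degree_smul_le _ _).trans_lt (by rw [H.degree_eq]; norm_num)
  · obtain rfl : m = 0 := by omega
    have h0 : L (P 0 * P 0) ≠ 0 := H.sqNorm_ne_zero 0
    rw [mul_sub, mul_sub, map_sub, map_sub, H.map_mul_of_ne zero_ne_one, mul_smul_comm, map_smul,
      jacobiB, sqNorm, smul_eq_mul, div_mul_cancel₀ _ h0, mul_comm (P 0) (X * P 0), sub_zero,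
      sub_self]

lemma add_two_eq (H : IsMonicOrthogonal L P) (n : ℕ) :
    P (n + 2) = (X - C (jacobiB L P (n + 1))) * P (n + 1) - C (jacobiA L P n) * P n := by
  suffices h : X * P (n + 1) - P (n + 2) - jacobiB L P (n + 1) • P (n + 1) -
      jacobiA L P n • P n = 0 by
    simp only [smul_eq_C_mul] at h
    linear_combination -h
  have h0 : ∀ n, L (P n * P n) ≠ 0 := H.sqNorm_ne_zero
  refine H.eq_zero_of_map_mul_eq_zero (n := n + 2) ?_ fun m hm => ?_
  · have hlt : ∀ k < n + 2, ∀ c : F, (c • P k).degree < ((n + 2 : ℕ) : WithBot ℕ) := fun k hk c =>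
      (degree_smul_le _ _).trans_lt (by rw [H.degree_eq]; exact_mod_cast hk)
    exact (degree_sub_le _ _).trans_lt (max_lt ((degree_sub_le _ _).trans_lt
      (max_lt (H.degree_X_mul_sub_succ_lt (n + 1)) (hlt _ (by omega) _))) (hlt _ (by omega) _))
  · simp only [mul_sub, map_sub, mul_smul_comm, map_smul, smul_eq_mul, H.map_mul_of_ne hm.ne,
      sub_zero]
    obtain hm | rfl | rfl : m + 1 < n + 1 ∨ m = n ∨ m = n + 1 := by omega
    · rw [H.map_mul_X_mul_of_lt hm, H.map_mul_of_ne (by omega), H.map_mul_of_ne (by omega)]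
      ring
    · rw [H.map_mul_X_mul_succ, H.map_mul_of_ne (by omega), jacobiA, sqNorm, sqNorm,
        div_mul_cancel₀ _ (h0 m)]
      ring
    · rw [H.map_mul_of_ne (by omega : n + 1 ≠ n), jacobiB, sqNorm, div_mul_cancel₀ _ (h0 (n + 1)),
        mul_comm (X * P (n + 1))]
      ring

lemma mem_recSolutions (H : IsMonicOrthogonal L P) : P ∈
    recSolutions (fun n => X - C (jacobiB L P (n + 1))) fun n => C (jacobiA L P n) :=
  H.add_two_eq

lemma jacobiA_ne_zero (H : IsMonicOrthogonal L P) (n : ℕ) : jacobiA L P n ≠ 0 :=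
  div_ne_zero (H.sqNorm_ne_zero _) (H.sqNorm_ne_zero _)

lemma prod_jacobiA (H : IsMonicOrthogonal L P) (k n : ℕ) :
    ∏ i ∈ range n, jacobiA L P (i + k) = sqNorm L P (n + k) / sqNorm L P k := by
  induction n with
  | zero => rw [prod_range_zero, zero_add, div_self (H.sqNorm_ne_zero k)]
  | succ n ih =>
    rw [prod_range_succ, ih, jacobiA, mul_comm, div_mul_div_cancel₀ (H.sqNorm_ne_zero _),
      add_right_comm]

lemma casoratian_secondKind (H : IsMonicOrthogonal L P) (n : ℕ) :
    casoratian P (secondKind L P) n = -C (sqNorm L P n) := by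
  have hprod := H.prod_jacobiA 0 n
  simp only [add_zero] at hprod
  rw [casoratian_eq_prod_mul H.mem_recSolutions secondKind_mem_recSolutions, ← map_prod, hprod]
  have h0 : casoratian P (secondKind L P) 0 = -C (sqNorm L P 0) := by
    simp [casoratian, secondKind, H.zero_eq_one]
  rw [h0, mul_neg, ← C_mul, div_mul_cancel₀ _ (H.sqNorm_ne_zero 0)]

lemma shiftCasoratian_ne_zero (H : IsMonicOrthogonal L P) {K : ℕ} (hK : K ≠ 0)
    (hB : Function.Periodic (jacobiB L P) K) : shiftCasoratian K P P ≠ 0 := by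
  obtain ⟨k, rfl⟩ := Nat.exists_eq_succ_of_ne_zero hK
  intro h
  have hB0 : jacobiB L P (k + 1) = jacobiB L P 0 := by simpa using hB 0
  have hB1 : jacobiB L P (k + 2) = jacobiB L P 1 := by simpa [add_comm 1] using hB 1
  have heq : C (jacobiA L P 0) * P (k + 2) = C (jacobiA L P (k + 1)) * (P 1 * P (k + 1)) := by
    rw [shiftCasoratian, Nat.succ_eq_add_one, H.add_two_eq (k + 1), H.add_two_eq 0, hB1,
      H.zero_eq_one] at h
    linear_combination h
  have hlead := congrArg leadingCoeff heq
  rw [leadingCoeff_mul, leadingCoeff_mul, leadingCoeff_C, leadingCoeff_C, (H.monic _).leadingCoeff,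
    ((H.monic 1).mul (H.monic (k + 1))).leadingCoeff, mul_one, mul_one] at hlead
  rw [← hlead] at heq
  have hprod := mul_left_cancel₀ (C_ne_zero.2 (H.jacobiA_ne_zero 0)) heq
  rw [H.add_two_eq k, hB0, ← H.one_eq, sub_eq_self] at hprod
  exact mul_ne_zero (C_ne_zero.2 (H.jacobiA_ne_zero k)) (H.monic k).ne_zero hprod

end IsMonicOrthogonal

section GramSchmidt

variable (hP : ∀ n, P n = X ^ n - ∑ k : Fin n, C (L (X ^ n * P k) / L (P k * P k)) * P k)

include hP

lemma monic_and_natDegree_of_gramSchmidt (n : ℕ) : (P n).Monic ∧ (P n).natDegree = n := by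
  induction n using Nat.strong_induction_on with
  | _ n ih =>
    have hlt : (∑ k : Fin n, C (L (X ^ n * P k) / L (P k * P k)) * P k).degree <
        (X ^ n : F[X]).degree := by
      rw [degree_X_pow]
      refine (degree_sum_le _ _).trans_lt ((Finset.sup_lt_iff (WithBot.bot_lt_coe n)).2 ?_)
      intro k _
      rw [← smul_eq_C_mul]
      refine (degree_smul_le _ _).trans_lt ?_
      rw [degree_eq_natDegree (ih k k.2).1.ne_zero, (ih k k.2).2]
      exact Nat.cast_lt.2 k.2
    rw [hP n]
    refine ⟨(monic_X_pow n).sub_of_left hlt, ?_⟩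
    rw [natDegree_eq_of_degree_eq (degree_sub_eq_left_of_degree_lt hlt), natDegree_X_pow]

lemma isMonicOrthogonal_of_gramSchmidt (hL : ∀ p : F[X], p ≠ 0 → L (p * p) ≠ 0) :
    IsMonicOrthogonal L P := by
  have hne : ∀ n, L (P n * P n) ≠ 0 := fun n =>
    hL _ (monic_and_natDegree_of_gramSchmidt hP n).1.ne_zero
  refine ⟨fun n => (monic_and_natDegree_of_gramSchmidt hP n).1,
    fun n => (monic_and_natDegree_of_gramSchmidt hP n).2, fun m n => ?_, hne⟩
  induction n using Nat.strong_induction_on generalizing m with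
  | _ n ih =>
    intro hmn
    rw [hP n, sub_mul, sum_mul, map_sub, map_sum, sum_eq_single ⟨m, hmn⟩]
    · rw [mul_assoc, ← smul_eq_C_mul, map_smul, smul_eq_mul, div_mul_cancel₀ _ (hne m), sub_self]
    · intro k _ hk
      rw [mul_assoc, ← smul_eq_C_mul, map_smul, smul_eq_mul]
      rcases (Fin.val_ne_iff.2 hk).lt_or_gt with h | h
      · rw [mul_comm (P k) (P m), ih m hmn k h, mul_zero]
      · rw [ih k k.2 m h, mul_zero]
    · simp

end GramSchmidt

end MomentFunctional

/-- The measure `ν` is carried by the compact set `E`. -/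
structure IsCompactCarrier (ν : Measure ℝ) (E : Set ℝ) : Prop where
  isCompact : IsCompact E
  ae_mem : ∀ᵐ x ∂ν, x ∈ E

/-- The Stieltjes (Cauchy) transform `∫ p(x) / (z - x) dν(x)` of the signed measure `p ν`. -/
noncomputable def cauchyTransform (ν : Measure ℝ) (p : ℝ[X]) (z : ℝ) : ℝ :=
  ∫ x, p.eval x * (z - x)⁻¹ ∂ν

section Carrier

variable {ν : Measure ℝ} {E : Set ℝ} {z : ℝ}

lemma IsCompactCarrier.eventually_notMem (hν : IsCompactCarrier ν E) : ∀ᶠ z in atTop, z ∉ E := by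
  obtain ⟨M, hM⟩ := hν.isCompact.bddAbove
  filter_upwards [eventually_gt_atTop M] with z hz hzE
  exact (hM hzE).not_gt hz

lemma continuousOn_inv_sub (hz : z ∉ E) : ContinuousOn (fun x => (z - x)⁻¹) E :=
  ContinuousOn.inv₀ (by fun_prop) fun _ hx => sub_ne_zero.2 fun h => hz (h ▸ hx)

variable [IsFiniteMeasure ν]

namespace IsCompactCarrier

lemma integrable (hν : IsCompactCarrier ν E) {f : ℝ → ℝ} (hf : ContinuousOn f E) :
    Integrable f ν := by
  rw [← Measure.restrict_eq_self_of_ae_mem hν.ae_mem]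
  exact hf.integrableOn_compact hν.isCompact

lemma integrable_eval (hν : IsCompactCarrier ν E) (p : ℝ[X]) : Integrable (fun x => p.eval x) ν :=
  hν.integrable p.continuousOn

lemma integrable_eval_mul_inv (hν : IsCompactCarrier ν E) (hz : z ∉ E) (p : ℝ[X]) :
    Integrable (fun x => p.eval x * (z - x)⁻¹) ν :=
  hν.integrable (p.continuousOn.mul (continuousOn_inv_sub hz))

/-- The moment functional `p ↦ ∫ p dν`. -/
noncomputable def momentFunctional (hν : IsCompactCarrier ν E) : ℝ[X] →ₗ[ℝ] ℝ where
  toFun p := ∫ x, p.eval x ∂ν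
  map_add' p q := by
    simp only [eval_add]
    exact integral_add (hν.integrable_eval p) (hν.integrable_eval q)
  map_smul' c p := by
    simp only [eval_smul, smul_eq_mul, integral_const_mul, RingHom.id_apply]

lemma momentFunctional_apply (hν : IsCompactCarrier ν E) (p : ℝ[X]) :
    hν.momentFunctional p = ∫ x, p.eval x ∂ν :=
  rfl

lemma cauchyTransform_X_sub_C_mul_sub (hν : IsCompactCarrier ν E) (hz : z ∉ E) (a b : ℝ)
    (p q : ℝ[X]) : cauchyTransform ν ((X - C b) * p - C a * q) z =
      (z - b) * cauchyTransform ν p z - hν.momentFunctional p - a * cauchyTransform ν q z := by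
  have hp := (hν.integrable_eval_mul_inv hz p).const_mul (z - b)
  have hp' := hν.integrable_eval p
  have hq := (hν.integrable_eval_mul_inv hz q).const_mul a
  simp only [cauchyTransform, momentFunctional_apply, ← integral_const_mul]
  rw [← integral_sub hp hp', ← integral_sub (by exact hp.sub hp') hq]
  refine integral_congr_ae ?_
  filter_upwards [hν.ae_mem] with x hx
  have hzx : z - x ≠ 0 := sub_ne_zero.2 fun h => hz (h ▸ hx)
  simp only [eval_sub, eval_mul, eval_X, eval_C]
  field_simp
  ring

lemma continuousOn_cauchyTransform (hν : IsCompactCarrier ν E) (p : ℝ[X]) :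
    ContinuousOn (cauchyTransform ν p) Eᶜ := by
  intro z hz
  obtain ⟨δ, hδ, hball⟩ := Metric.mem_nhds_iff.1 (hν.isCompact.isClosed.isOpen_compl.mem_nhds hz)
  have hdist : ∀ x ∈ E, δ ≤ |z - x| := fun x hx => by
    by_contra! h
    exact hball (Metric.mem_ball'.2 h) hx
  refine ContinuousAt.continuousWithinAt (continuousAt_of_dominated
    (bound := fun x => |p.eval x| * (δ / 2)⁻¹) (.of_forall fun y => ?_) ?_
    ((hν.integrable_eval p).abs.mul_const _) ?_)
  · exact (p.continuous.measurable.mul (by fun_prop)).aestronglyMeasurable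
  · filter_upwards [Metric.ball_mem_nhds z (half_pos hδ)] with y hy
    filter_upwards [hν.ae_mem] with x hx
    rw [norm_mul, norm_inv, Real.norm_eq_abs, Real.norm_eq_abs]
    have hyz : |z - y| < δ / 2 := Metric.mem_ball'.1 hy
    have hyx : δ / 2 ≤ |y - x| := by linarith [abs_sub_le z y x, hdist x hx]
    gcongr
  · filter_upwards [hν.ae_mem] with x hx
    have hzx : z - x ≠ 0 := sub_ne_zero.2 fun h => hz (h ▸ hx)
    fun_prop (disch := exact hzx)

end IsCompactCarrier

namespace IsMonicOrthogonal

variable {hν : IsCompactCarrier ν E} {P : ℕ → ℝ[X]}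

lemma sqNorm_pos (H : IsMonicOrthogonal hν.momentFunctional P) (n : ℕ) :
    0 < sqNorm hν.momentFunctional P n := by
  refine (H.sqNorm_ne_zero n).symm.lt_of_le ?_
  rw [sqNorm, hν.momentFunctional_apply]
  simp only [eval_mul]
  exact integral_nonneg fun x => mul_self_nonneg _

lemma not_ae_eval_eq_zero (H : IsMonicOrthogonal hν.momentFunctional P) (n : ℕ) :
    ¬ ∀ᵐ x ∂ν, (P n).eval x = 0 := by
  intro h
  refine H.sqNorm_ne_zero n ?_
  rw [sqNorm, hν.momentFunctional_apply]
  refine integral_eq_zero_of_ae ?_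
  filter_upwards [h] with x hx
  simp [hx]

lemma cauchyTransform_mem_recSolutions (H : IsMonicOrthogonal hν.momentFunctional P) (hz : z ∉ E) :
    (fun n => cauchyTransform ν (P n) z) ∈
      recSolutions (fun n => z - jacobiB hν.momentFunctional P (n + 1))
        (jacobiA hν.momentFunctional P) := fun n => by
  have h0 := H.orthogonal 0 (n + 1) n.succ_pos
  rw [H.zero_eq_one, mul_one] at h0
  simp only [H.add_two_eq n, hν.cauchyTransform_X_sub_C_mul_sub hz, h0, sub_zero]

lemma cauchyTransform_eq (H : IsMonicOrthogonal hν.momentFunctional P) (hz : z ∉ E) (n : ℕ) :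
    cauchyTransform ν (P n) z = cauchyTransform ν (P 0) z * (P n).eval z -
      (secondKind hν.momentFunctional P n).eval z := by
  have hP := eval_mem_recSolutions H.mem_recSolutions z
  have hQ := eval_mem_recSolutions (secondKind_mem_recSolutions (L := hν.momentFunctional)
    (P := P)) z
  simp only [eval_sub, eval_X, eval_C] at hP hQ
  refine eq_of_mem_recSolutions (H.cauchyTransform_mem_recSolutions hz)
    (sub_mem (Submodule.smul_mem _ (cauchyTransform ν (P 0) z) hP) hQ) ?_ ?_ n
  · simp [secondKind, H.zero_eq_one]
  · have h1 := hν.cauchyTransform_X_sub_C_mul_sub hz 0 (jacobiB hν.momentFunctional P 0) 1 0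
    simp only [C_0, zero_mul, sub_zero, mul_one] at h1
    simp [secondKind, H.one_eq, H.zero_eq_one, h1, sqNorm, mul_comm]

lemma casoratian_cauchyTransform (H : IsMonicOrthogonal hν.momentFunctional P) (hz : z ∉ E)
    (n : ℕ) : casoratian (fun n => (P n).eval z) (fun n => cauchyTransform ν (P n) z) n =
      sqNorm hν.momentFunctional P n := by
  have h := congrArg (eval z) (H.casoratian_secondKind n)
  simp only [casoratian, eval_sub, eval_mul, eval_neg, eval_C] at h
  simp only [casoratian, H.cauchyTransform_eq hz n, H.cauchyTransform_eq hz (n + 1)]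
  linear_combination -h

lemma eval_mul_cauchyTransform (H : IsMonicOrthogonal hν.momentFunctional P) (hz : z ∉ E) {n : ℕ}
    {q : ℝ[X]} (hq : q.natDegree ≤ n) :
    q.eval z * cauchyTransform ν (P n) z = cauchyTransform ν (P n * q) z := by
  have hLr : hν.momentFunctional (P n * (q /ₘ (X - C z))) = 0 := by
    by_cases hq0 : q = 0
    · simp [hq0]
    · refine H.map_mul_eq_zero ((degree_divByMonic_lt q (X - C z) hq0 ?_).trans_le
        (natDegree_le_iff_degree_le.1 hq))
      rw [degree_X_sub_C]
      exact one_pos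
  rw [hν.momentFunctional_apply] at hLr
  rw [← sub_zero (_ * _), ← hLr, cauchyTransform, cauchyTransform, ← integral_const_mul,
    ← integral_sub ((hν.integrable_eval_mul_inv hz _).const_mul _) (hν.integrable_eval _)]
  refine integral_congr_ae ?_
  filter_upwards [hν.ae_mem] with x hx
  have hzx : z - x ≠ 0 := sub_ne_zero.2 fun h => hz (h ▸ hx)
  have hdiv := congrArg (eval x) (modByMonic_add_div q (X - C z))
  simp only [modByMonic_X_sub_C_eq_C_eval, eval_add, eval_mul, eval_sub, eval_X, eval_C] at hdiv
  simp only [eval_mul]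
  field_simp
  linear_combination (P n).eval x * hdiv

lemma sum_sq_integral_mul_div_sqNorm_le (H : IsMonicOrthogonal hν.momentFunctional P) {f : ℝ → ℝ}
    (hf : ContinuousOn f E) (N : ℕ) :
    ∑ m ∈ range N, (∫ x, (P m).eval x * f x ∂ν) ^ 2 / sqNorm hν.momentFunctional P m ≤
      ∫ x, f x ^ 2 ∂ν := by
  set L := hν.momentFunctional
  set c : ℕ → ℝ := fun m => (∫ x, (P m).eval x * f x ∂ν) / sqNorm L P m
  set S : ℝ[X] := ∑ m ∈ range N, c m • P m
  set B : ℝ := ∑ m ∈ range N, (∫ x, (P m).eval x * f x ∂ν) ^ 2 / sqNorm L P m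
  have hfS : ∫ x, S.eval x * f x ∂ν = B := by
    simp only [S, eval_finsetSum, sum_mul, eval_smul, smul_eq_mul, mul_assoc]
    rw [integral_finsetSum _ fun m _ => (hν.integrable (f := fun x => (P m).eval x * f x)
      ((P m).continuousOn.mul hf)).const_mul _]
    refine sum_congr rfl fun m _ => ?_
    rw [integral_const_mul, div_mul_eq_mul_div, sq]
  have hSS : ∫ x, S.eval x ^ 2 ∂ν = B := by
    have hLS : L (S * S) = B := by
      rw [H.map_sum_smul_mul_self]
      refine sum_congr rfl fun m _ => ?_
      have := H.sqNorm_ne_zero m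
      simp only [c]
      field_simp
    rw [← hLS, hν.momentFunctional_apply]
    simp only [eval_mul, sq]
  have hnonneg : 0 ≤ ∫ x, (f x ^ 2 - 2 * (S.eval x * f x) + S.eval x ^ 2) ∂ν :=
    integral_nonneg fun x => by
      have := sq_nonneg (f x - S.eval x)
      simp only [Pi.zero_apply]
      linarith
  have hff : Integrable (fun x => f x ^ 2) ν := hν.integrable (hf.pow 2)
  have hSf : Integrable (fun x => 2 * (S.eval x * f x)) ν :=
    (hν.integrable (S.continuousOn.mul hf)).const_mul 2
  have hSS' : Integrable (fun x => S.eval x ^ 2) ν := hν.integrable (S.continuousOn.pow 2)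
  rw [integral_add (by exact hff.sub hSf) hSS', integral_sub hff hSf, integral_const_mul, hfS,
    hSS] at hnonneg
  linarith

lemma tendsto_cauchyTransform_sq_div_sqNorm (H : IsMonicOrthogonal hν.momentFunctional P)
    (hz : z ∉ E) : Tendsto
      (fun n => cauchyTransform ν (P n) z ^ 2 / sqNorm hν.momentFunctional P n) atTop (𝓝 0) :=
  (summable_of_sum_range_le (fun n => div_nonneg (sq_nonneg _) (H.sqNorm_pos n).le)
    (H.sum_sq_integral_mul_div_sqNorm_le
      (continuousOn_inv_sub hz))).tendsto_atTop_zero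

end IsMonicOrthogonal

end Carrier

/-- The diagonal Green's function `p(z) ∫ p(x) / (z - x) dν(x)` of the orthogonal polynomial `p`. -/
noncomputable def greenDiag (ν : Measure ℝ) (p : ℝ[X]) (z : ℝ) : ℝ :=
  p.eval z * cauchyTransform ν p z

lemma le_or_le_of_mem_of_gap {E : Set ℝ} {a b x : ℝ} (hgap : Set.Ioo a b ⊆ Eᶜ) (hx : x ∈ E) :
    x ≤ a ∨ b ≤ x := by
  by_contra! h
  exact hgap h hx

lemma inv_sub_sub_inv_sub_pos {E : Set ℝ} {a b u v x : ℝ} (hgap : Set.Ioo a b ⊆ Eᶜ) (hau : a < u)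
    (huv : u < v) (hvb : v < b) (hx : x ∈ E) : 0 < (u - x)⁻¹ - (v - x)⁻¹ := by
  rw [sub_pos]
  rcases le_or_le_of_mem_of_gap hgap hx with h | h
  · exact inv_strictAnti₀ (by linarith) (by linarith)
  · exact inv_lt_inv_of_neg (by linarith) (by linarith) |>.2 (by linarith)

section Gap

variable {ν : Measure ℝ} [IsFiniteMeasure ν] {E : Set ℝ} {P : ℕ → ℝ[X]} {a b u v : ℝ}

lemma IsCompactCarrier.continuousOn_greenDiag (hν : IsCompactCarrier ν E) (p : ℝ[X]) :
    ContinuousOn (greenDiag ν p) Eᶜ :=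
  p.continuousOn.mul (hν.continuousOn_cauchyTransform p)

namespace IsMonicOrthogonal

variable {hν : IsCompactCarrier ν E}

lemma strictAntiOn_greenDiag (H : IsMonicOrthogonal hν.momentFunctional P)
    (hgap : Set.Ioo a b ⊆ Eᶜ) (n : ℕ) : StrictAntiOn (greenDiag ν (P n)) (Set.Ioo a b) := by
  intro u hu v hv huv
  have hpos : ∀ᵐ x ∂ν, 0 < (u - x)⁻¹ - (v - x)⁻¹ := by
    filter_upwards [hν.ae_mem] with x hx
    exact inv_sub_sub_inv_sub_pos hgap hu.1 huv hv.2 hx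
  have hiu := hν.integrable_eval_mul_inv (hgap hu) (P n * P n)
  have hiv := hν.integrable_eval_mul_inv (hgap hv) (P n * P n)
  have hnonneg : 0 ≤ᵐ[ν] fun x =>
      (P n * P n).eval x * (u - x)⁻¹ - (P n * P n).eval x * (v - x)⁻¹ := by
    filter_upwards [hpos] with x hx
    rw [Pi.zero_apply, ← mul_sub, eval_mul]
    exact mul_nonneg (mul_self_nonneg _) hx.le
  rw [greenDiag, greenDiag, H.eval_mul_cauchyTransform (hgap hu) (H.natDegree n).le,
    H.eval_mul_cauchyTransform (hgap hv) (H.natDegree n).le, ← sub_pos, cauchyTransform,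
    cauchyTransform, ← integral_sub hiu hiv]
  refine (integral_nonneg_of_ae hnonneg).lt_of_ne' fun h => H.not_ae_eval_eq_zero n ?_
  filter_upwards [hpos, (integral_eq_zero_iff_of_nonneg_ae hnonneg (hiu.sub hiv)).1 h] with x hx h0
  rw [Pi.zero_apply, ← mul_sub, eval_mul] at h0
  exact mul_self_eq_zero.1 ((mul_eq_zero.1 h0).resolve_right hx.ne')

lemma eval_ne_zero_of_eval_eq_zero (H : IsMonicOrthogonal hν.momentFunctional P) (huv : u ≠ v)
    (hsign : ∀ x ∈ E, 0 ≤ (x - u) * (x - v)) {n : ℕ} (hu : (P n).eval u = 0) :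
    (P n).eval v ≠ 0 := by
  intro hv
  obtain ⟨R, hR⟩ := (isCoprime_X_sub_C_of_isUnit_sub (sub_ne_zero.2 huv).isUnit).mul_dvd
    (dvd_iff_isRoot.2 hu) (dvd_iff_isRoot.2 hv)
  have hdeg : R.degree < n := by
    have hR0 : R ≠ 0 := by
      rintro rfl
      exact (H.monic n).ne_zero (by rw [hR, mul_zero])
    have := H.degree_eq n
    rw [hR, degree_mul, degree_mul, degree_X_sub_C, degree_X_sub_C,
      degree_eq_natDegree hR0] at this
    rw [degree_eq_natDegree hR0]
    norm_cast at this ⊢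
    omega
  have hint := H.map_mul_eq_zero hdeg
  have heval : ∀ x, (P n * R).eval x = (x - u) * (x - v) * R.eval x ^ 2 := fun x => by
    rw [hR]
    simp only [eval_mul, eval_sub, eval_X, eval_C]
    ring
  rw [hν.momentFunctional_apply, integral_eq_zero_iff_of_nonneg_ae _ (hν.integrable_eval _)] at hint
  · refine H.not_ae_eval_eq_zero n ?_
    filter_upwards [hint] with x hx
    rw [Pi.zero_apply, heval] at hx
    have : (P n).eval x ^ 2 = 0 := by
      rw [hR]
      simp only [eval_mul, eval_sub, eval_X, eval_C]
      linear_combination (x - u) * (x - v) * hx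
    exact pow_eq_zero_iff two_ne_zero |>.1 this
  · filter_upwards [hν.ae_mem] with x hx
    rw [Pi.zero_apply, heval]
    exact mul_nonneg (hsign x hx) (sq_nonneg _)

lemma eval_right_ne_zero_of_mem_gap (H : IsMonicOrthogonal hν.momentFunctional P)
    (hgap : Set.Ioo a b ⊆ Eᶜ) (hu : u ∈ Set.Ioo a b) {n : ℕ} (hPu : (P n).eval u = 0) :
    (P n).eval b ≠ 0 :=
  H.eval_ne_zero_of_eval_eq_zero hu.2.ne (fun x hx => by
    rcases le_or_le_of_mem_of_gap hgap hx with h | h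
    · exact mul_nonneg_of_nonpos_of_nonpos (by linarith [hu.1]) (by linarith [hu.1, hu.2])
    · exact mul_nonneg (by linarith [hu.2]) (by linarith)) hPu

lemma cauchyTransform_ne_zero_of_mem_gap (H : IsMonicOrthogonal hν.momentFunctional P)
    (hgap : Set.Ioo a b ⊆ Eᶜ) (hu : u ∈ Set.Ioo a b) {n : ℕ} (hPu : (P n).eval u = 0)
    (hv : v ∈ Set.Ioo a b) : cauchyTransform ν (P n) v ≠ 0 := by
  intro hψ
  obtain rfl : v = u := (H.strictAntiOn_greenDiag hgap n).injOn hv hu (by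
    rw [greenDiag, greenDiag, hψ, hPu, mul_zero, zero_mul])
  refine H.sqNorm_ne_zero n ?_
  rw [← H.casoratian_cauchyTransform (hgap hv) n, casoratian, hψ, hPu, mul_zero, zero_mul, sub_zero]

end IsMonicOrthogonal

end Gap

lemma eq_zero_of_sq_eq_sq_mul {R : Type*} [CommRing R] [IsDomain R] {s p q : R[X]} {x : R}
    (hq : Odd (q.rootMultiplicity x)) (h : s ^ 2 = p ^ 2 * q) : p = 0 := by
  by_contra hp
  have hq0 : q ≠ 0 := by
    rintro rfl
    simp at hq
  have hs : s ≠ 0 := by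
    rintro rfl
    rw [zero_pow two_ne_zero] at h
    exact mul_ne_zero (pow_ne_zero 2 hp) hq0 h.symm
  have hmult := congrArg (rootMultiplicity x) h
  rw [rootMultiplicity_mul (mul_ne_zero (pow_ne_zero 2 hp) hq0), sq, sq,
    rootMultiplicity_mul (mul_ne_zero hs hs), rootMultiplicity_mul (mul_ne_zero hp hp)] at hmult
  obtain ⟨k, hk⟩ := hq
  omega

lemma eq_of_eventually_eval_eq {p q : ℝ[X]} (h : ∀ᶠ z in atTop, p.eval z = q.eval z) : p = q := by
  obtain ⟨M, hM⟩ := eventually_atTop.1 h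
  exact eq_of_infinite_eval_eq p q ((Set.Ici_infinite M).mono hM)

lemma eventually_eval_ne_zero {R : Type*} [CommRing R] [IsDomain R] [TopologicalSpace R] [T1Space R]
    {p : R[X]} (hp : p ≠ 0) (x : R) : ∀ᶠ z in 𝓝[≠] x, p.eval z ≠ 0 := by
  filter_upwards [nhdsNE_of_nhdsNE_sdiff_finite univ_mem (finite_setOfPred_isRoot hp)] with z hz
  exact hz.2

section Quadratic

variable {ν : Measure ℝ} [IsFiniteMeasure ν] {E : Set ℝ} {hν : IsCompactCarrier ν E}
  {P : ℕ → ℝ[X]} {K : ℕ} {z : ℝ}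

namespace IsMonicOrthogonal

lemma jacobiA_pos (H : IsMonicOrthogonal hν.momentFunctional P) (n : ℕ) :
    0 < jacobiA hν.momentFunctional P n :=
  div_pos (H.sqNorm_pos _) (H.sqNorm_pos _)

lemma tail_cauchyTransform_mem_recSolutions (H : IsMonicOrthogonal hν.momentFunctional P)
    (hz : z ∉ E) : (fun n => cauchyTransform ν (P (n + 1)) z) ∈
      recSolutions (fun n => z - jacobiB hν.momentFunctional P (n + 2))
        fun n => jacobiA hν.momentFunctional P (n + 1) :=
  fun n => H.cauchyTransform_mem_recSolutions hz (n + 1)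

lemma tendsto_tail_cauchyTransform (H : IsMonicOrthogonal hν.momentFunctional P) (hz : z ∉ E) :
    Tendsto (fun n => cauchyTransform ν (P (n + 1)) z ^ 2 /
      ∏ i ∈ range n, jacobiA hν.momentFunctional P (i + 1)) atTop (𝓝 0) := by
  have h := ((tendsto_add_atTop_iff_nat 1).2
    (H.tendsto_cauchyTransform_sq_div_sqNorm hz)).mul_const (sqNorm hν.momentFunctional P 1)
  rw [zero_mul] at h
  refine h.congr fun n => ?_
  rw [H.prod_jacobiA, div_div_eq_mul_div, div_mul_eq_mul_div]

end IsMonicOrthogonal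

lemma HasPeriodicJacobi.periodic_const_sub {L : ℝ[X] →ₗ[ℝ] ℝ} (hper : HasPeriodicJacobi L P K)
    (z : ℝ) : Function.Periodic (fun n => z - jacobiB L P (n + 2)) K := fun n => by
  simp only [add_right_comm n K 2, hper.periodic_jacobiB (n + 2)]

namespace IsMonicOrthogonal

variable (H : IsMonicOrthogonal hν.momentFunctional P)
  (hper : HasPeriodicJacobi hν.momentFunctional P K)

include H hper

lemma shiftCasoratian_cauchyTransform_eq_zero (hz : z ∉ E) :
    shiftCasoratian K (fun n => cauchyTransform ν (P n) z)
      (fun n => cauchyTransform ν (P n) z) = 0 := by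
  rw [← casoratian_shift_tail]
  exact casoratian_shift_eq_zero_of_tendsto (hper.periodic_const_sub z) hper.periodic_jacobiA
    (fun n => H.jacobiA_pos (n + 1)) hper.ne_zero (H.tail_cauchyTransform_mem_recSolutions hz)
    (H.tendsto_tail_cauchyTransform hz)

lemma quadratic_cauchyTransform (hz : z ∉ E) :
    (shiftCasoratian K P P).eval z * cauchyTransform ν (P 0) z ^ 2 -
      (shiftCasoratian K P (secondKind hν.momentFunctional P) +
        shiftCasoratian K (secondKind hν.momentFunctional P) P).eval z *
          cauchyTransform ν (P 0) z +
      (shiftCasoratian K (secondKind hν.momentFunctional P)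
        (secondKind hν.momentFunctional P)).eval z = 0 := by
  have h := H.shiftCasoratian_cauchyTransform_eq_zero hper hz
  rw [shiftCasoratian, H.cauchyTransform_eq hz 1, H.cauchyTransform_eq hz 2,
    H.cauchyTransform_eq hz (K + 1), H.cauchyTransform_eq hz (K + 2)] at h
  simp only [shiftCasoratian, eval_add, eval_sub, eval_mul]
  linear_combination h

lemma shiftCasoratian_secondKind_symm {N D : ℝ[X]} {x : ℝ}
    (hodd : Odd ((N * D).rootMultiplicity x))
    (hF : ∀ᶠ z in atTop, cauchyTransform ν (P 0) z ^ 2 * D.eval z = N.eval z) :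
    shiftCasoratian K P (secondKind hν.momentFunctional P) +
      shiftCasoratian K (secondKind hν.momentFunctional P) P = 0 := by
  set Q := secondKind hν.momentFunctional P
  refine eq_zero_of_sq_eq_sq_mul (s := shiftCasoratian K P P * N + shiftCasoratian K Q Q * D)
    hodd (eq_of_eventually_eval_eq ?_)
  filter_upwards [hF, hν.eventually_notMem] with z hFz hz
  have hquad := H.quadratic_cauchyTransform hper hz
  have hlin : (shiftCasoratian K P P * N + shiftCasoratian K Q Q * D).eval z =
      (shiftCasoratian K P Q + shiftCasoratian K Q P).eval z *
        (cauchyTransform ν (P 0) z * D.eval z) := by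
    simp only [eval_add, eval_mul, ← hFz] at hquad ⊢
    linear_combination D.eval z * hquad
  rw [eval_pow, hlin, eval_mul, eval_pow, eval_mul, ← hFz]
  ring

lemma cauchyTransform_sq_mul_eval {N D : ℝ[X]} {x : ℝ}
    (hodd : Odd ((N * D).rootMultiplicity x))
    (hF : ∀ᶠ z in atTop, cauchyTransform ν (P 0) z ^ 2 * D.eval z = N.eval z) (hz : z ∉ E) :
    cauchyTransform ν (P 0) z ^ 2 * D.eval z = N.eval z := by
  set Q := secondKind hν.momentFunctional P
  have hquad : ∀ y ∉ E, (shiftCasoratian K P P).eval y * cauchyTransform ν (P 0) y ^ 2 +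
      (shiftCasoratian K Q Q).eval y = 0 := fun y hy => by
    have := H.quadratic_cauchyTransform hper hy
    rwa [H.shiftCasoratian_secondKind_symm hper hodd hF, eval_zero, zero_mul, sub_zero] at this
  have hpoly : shiftCasoratian K P P * N + shiftCasoratian K Q Q * D = 0 := by
    refine eq_of_eventually_eval_eq ?_
    filter_upwards [hF, hν.eventually_notMem] with y hFy hy
    simp only [eval_add, eval_mul, eval_zero, ← hFy]
    linear_combination D.eval y * hquad y hy
  have hEc := hν.isCompact.isClosed.isOpen_compl.mem_nhds hz
  have hcont := ((hν.continuousOn_cauchyTransform (P 0)).continuousAt hEc).pow 2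
  refine tendsto_nhds_unique_of_eventuallyEq (l := 𝓝[≠] z)
    ((hcont.mul D.continuousAt).tendsto.mono_left nhdsWithin_le_nhds)
    (N.continuousAt.tendsto.mono_left nhdsWithin_le_nhds) ?_
  filter_upwards [eventually_eval_ne_zero
    (H.shiftCasoratian_ne_zero hper.ne_zero hper.periodic_jacobiB) z,
    mem_nhdsWithin_of_mem_nhds hEc] with y hy0 hy
  have heval := congrArg (eval y) hpoly
  simp only [eval_add, eval_mul, eval_zero] at heval
  refine mul_left_cancel₀ hy0 ?_
  simp only [Pi.mul_apply, Pi.pow_apply]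
  linear_combination D.eval y * hquad y hy - heval

end IsMonicOrthogonal

end Quadratic

section EdgeBehaviour

variable {f : ℝ → ℝ} {N D : ℝ[X]} {a b : ℝ}
  (hf : ∀ z ∈ Set.Ioo a b, f z ^ 2 * D.eval z = N.eval z) (hab : a < b)

include hf hab

lemma tendsto_zero_of_sq_mul_eval_eq (hNa : N.eval a = 0) (hDa : D.eval a ≠ 0) :
    Tendsto f (𝓝[>] a) (𝓝 0) := by
  have hsq : Tendsto (fun z => N.eval z / D.eval z) (𝓝[>] a) (𝓝 0) := by
    rw [show (0 : ℝ) = N.eval a / D.eval a by rw [hNa, zero_div]]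
    exact (N.continuousAt.div D.continuousAt hDa).tendsto.mono_left nhdsWithin_le_nhds
  rw [tendsto_zero_iff_abs_tendsto_zero, ← Real.sqrt_zero]
  refine hsq.sqrt.congr' ?_
  filter_upwards [Ioo_mem_nhdsGT hab, mem_nhdsWithin_of_mem_nhds
    (D.continuousAt.eventually_ne hDa)] with z hz hDz
  rw [← hf z hz, mul_div_cancel_right₀ _ hDz, Real.sqrt_sq_eq_abs, Function.comp_apply]

lemma eventually_eval_sq_lt_sq_mul_eval_sq (hNb : N.eval b ≠ 0) (hDb : D.eval b = 0)
    {p : ℝ[X]} (hp : p.eval b ≠ 0) (q : ℝ[X]) :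
    ∀ᶠ z in 𝓝[<] b, q.eval z ^ 2 < f z ^ 2 * p.eval z ^ 2 := by
  have hcont : ContinuousAt (fun z => |N.eval z| * p.eval z ^ 2 - |D.eval z| * q.eval z ^ 2) b :=
    (N.continuousAt.abs.mul (p.continuousAt.pow 2)).sub
      (D.continuousAt.abs.mul (q.continuousAt.pow 2))
  have hpos : 0 < |N.eval b| * p.eval b ^ 2 - |D.eval b| * q.eval b ^ 2 := by
    rw [hDb, abs_zero, zero_mul, sub_zero]
    positivity
  filter_upwards [mem_nhdsWithin_of_mem_nhds (hcont.eventually_const_lt hpos),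
    Ioo_mem_nhdsLT hab] with z hz hzab
  rw [← hf z hzab, abs_mul, abs_of_nonneg (sq_nonneg _)] at hz
  refine lt_of_mul_lt_mul_left ?_ (abs_nonneg (D.eval z))
  linarith

end EdgeBehaviour

section Comparison

variable {ν : Measure ℝ} [IsFiniteMeasure ν] {E : Set ℝ} {hν : IsCompactCarrier ν E}
  {P : ℕ → ℝ[X]} {K n : ℕ} {a b y z : ℝ} {N D : ℝ[X]}

/-- The second branch `F Pₙ + Qₙ` of `cauchyTransform ν (P n) = F Pₙ - Qₙ`, up to sign, obtained by
changing the sign of `F = cauchyTransform ν (P 0)`. -/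
noncomputable def conjTransform (hν : IsCompactCarrier ν E) (P : ℕ → ℝ[X]) (n : ℕ) (z : ℝ) : ℝ :=
  cauchyTransform ν (P 0) z * (P n).eval z + (secondKind hν.momentFunctional P n).eval z

namespace IsMonicOrthogonal

section Conj

variable (H : IsMonicOrthogonal hν.momentFunctional P)

include H

lemma tail_conjTransform_mem_recSolutions :
    (fun n => conjTransform hν P (n + 1) z) ∈
      recSolutions (fun n => z - jacobiB hν.momentFunctional P (n + 2))
        fun n => jacobiA hν.momentFunctional P (n + 1) := fun n => by
  have hP := eval_mem_recSolutions H.mem_recSolutions z (n + 1)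
  have hQ := eval_mem_recSolutions (secondKind_mem_recSolutions (L := hν.momentFunctional)
    (P := P)) z (n + 1)
  simp only [eval_sub, eval_X, eval_C] at hP hQ
  simp only [conjTransform, hP, hQ]
  ring

lemma casoratian_cauchyTransform_conjTransform (hz : z ∉ E) (n : ℕ) :
    casoratian (fun n => cauchyTransform ν (P n) z) (fun n => conjTransform hν P n z) n =
      -2 * cauchyTransform ν (P 0) z * sqNorm hν.momentFunctional P n := by
  have h := H.casoratian_cauchyTransform hz n
  simp only [casoratian, H.cauchyTransform_eq hz n, H.cauchyTransform_eq hz (n + 1)] at h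
  simp only [casoratian, conjTransform, H.cauchyTransform_eq hz n, H.cauchyTransform_eq hz (n + 1)]
  linear_combination -2 * cauchyTransform ν (P 0) z * h

lemma cauchyTransform_mul_conjTransform (hz : z ∉ E) (n : ℕ) :
    cauchyTransform ν (P n) z * conjTransform hν P n z =
      cauchyTransform ν (P 0) z ^ 2 * (P n).eval z ^ 2 -
        (secondKind hν.momentFunctional P n).eval z ^ 2 := by
  rw [conjTransform, H.cauchyTransform_eq hz n]
  ring

lemma two_mul_greenDiag (hz : z ∉ E) (n : ℕ) :
    2 * cauchyTransform ν (P 0) z * greenDiag ν (P n) z =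
      cauchyTransform ν (P n) z ^ 2 + cauchyTransform ν (P n) z * conjTransform hν P n z := by
  rw [conjTransform, greenDiag, H.cauchyTransform_eq hz n]
  ring

variable (hper : HasPeriodicJacobi hν.momentFunctional P K)

include hper

lemma exists_isFloquet_cauchyTransform (hz : z ∉ E) :
    ∃ l, IsFloquet K l (fun n => cauchyTransform ν (P (n + 1)) z) ∧
      l ^ 2 < ∏ i ∈ range K, jacobiA hν.momentFunctional P (i + 1) := by
  have h0 : cauchyTransform ν (P 1) z ≠ 0 ∨ cauchyTransform ν (P 2) z ≠ 0 := by
    by_contra! h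
    refine H.sqNorm_ne_zero 1 ?_
    rw [← H.casoratian_cauchyTransform hz 1, casoratian, h.1, h.2, mul_zero, mul_zero, sub_zero]
  obtain ⟨l, hl⟩ := exists_isFloquet (hper.periodic_const_sub z) hper.periodic_jacobiA
    (H.tail_cauchyTransform_mem_recSolutions hz) h0
    (casoratian_shift_tail.trans (H.shiftCasoratian_cauchyTransform_eq_zero hper hz))
  refine ⟨l, hl, hl.sq_lt_prod hper.periodic_jacobiA (fun n => H.jacobiA_pos _) hper.ne_zero
    (fun h => ?_) (H.tendsto_tail_cauchyTransform hz)⟩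
  exact h0.elim (fun h0 => h0 (congrFun h 0)) fun h0 => h0 (congrFun h 1)

variable (hsymm : shiftCasoratian K P (secondKind hν.momentFunctional P) +
  shiftCasoratian K (secondKind hν.momentFunctional P) P = 0)

include hsymm

lemma shiftCasoratian_conjTransform_eq_zero (hz : z ∉ E) :
    shiftCasoratian K (fun n => conjTransform hν P n z) (fun n => conjTransform hν P n z) = 0 := by
  have hquad := H.quadratic_cauchyTransform hper hz
  have hmid := congrArg (eval z) hsymm
  rw [hsymm] at hquad
  simp only [shiftCasoratian, eval_add, eval_sub, eval_mul, eval_zero] at hquad hmid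
  simp only [shiftCasoratian, conjTransform]
  linear_combination hquad + cauchyTransform ν (P 0) z * hmid

lemma exists_isFloquet_conjTransform (hz : z ∉ E) (hF : cauchyTransform ν (P 0) z ≠ 0) {l : ℝ}
    (hl : IsFloquet K l (fun n => cauchyTransform ν (P (n + 1)) z)) :
    ∃ k, IsFloquet K k (fun n => conjTransform hν P (n + 1) z) ∧
      l * k = ∏ i ∈ range K, jacobiA hν.momentFunctional P (i + 1) := by
  have hcas : casoratian (fun n => cauchyTransform ν (P (n + 1)) z)
      (fun n => conjTransform hν P (n + 1) z) 0 ≠ 0 := by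
    have h := H.casoratian_cauchyTransform_conjTransform hz 1
    simp only [casoratian] at h ⊢
    rw [h]
    exact mul_ne_zero (mul_ne_zero (by norm_num) hF) (H.sqNorm_ne_zero 1)
  have h0 : conjTransform hν P 1 z ≠ 0 ∨ conjTransform hν P 2 z ≠ 0 := by
    by_contra! h
    simp [casoratian, h.1, h.2] at hcas
  obtain ⟨k, hk⟩ := exists_isFloquet (hper.periodic_const_sub z) hper.periodic_jacobiA
    H.tail_conjTransform_mem_recSolutions h0
    (casoratian_shift_tail.trans (H.shiftCasoratian_conjTransform_eq_zero hper hsymm hz))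
  exact ⟨k, hk, hl.mul_eq_prod hk (H.tail_cauchyTransform_mem_recSolutions hz)
    H.tail_conjTransform_mem_recSolutions hcas⟩

lemma mul_greenDiag_le_greenDiag_add (hz : z ∉ E) (hF : cauchyTransform ν (P 0) z < 0) (n : ℕ) :
    (∏ i ∈ range K, jacobiA hν.momentFunctional P (i + 1)) * greenDiag ν (P (n + 1)) z ≤
      greenDiag ν (P (n + K + 1)) z := by
  obtain ⟨l, hl, hlt⟩ := H.exists_isFloquet_cauchyTransform hper hz
  obtain ⟨k, hk, hlk⟩ := H.exists_isFloquet_conjTransform hper hsymm hz hF.ne hl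
  have hln : cauchyTransform ν (P (n + K + 1)) z = l * cauchyTransform ν (P (n + 1)) z := hl n
  have hkn : conjTransform hν P (n + K + 1) z = k * conjTransform hν P (n + 1) z := hk n
  have hG := H.two_mul_greenDiag hz (n + 1)
  have hGK := H.two_mul_greenDiag hz (n + K + 1)
  rw [hln, hkn] at hGK
  rw [← hlk] at hlt ⊢
  have hle := mul_le_mul_of_nonneg_right hlt.le (sq_nonneg (cauchyTransform ν (P (n + 1)) z))
  refine (mul_le_mul_left_of_neg (show 2 * cauchyTransform ν (P 0) z < 0 by linarith)).1 ?_
  linear_combination hGK - l * k * hG + hle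

lemma greenDiag_add_neg (hz : z ∉ E) (hF : cauchyTransform ν (P 0) z < 0)
    (hlt : (secondKind hν.momentFunctional P (n + 1)).eval z ^ 2 <
      cauchyTransform ν (P 0) z ^ 2 * (P (n + 1)).eval z ^ 2) :
    greenDiag ν (P (n + K + 1)) z < 0 := by
  obtain ⟨l, hl, -⟩ := H.exists_isFloquet_cauchyTransform hper hz
  obtain ⟨k, hk, hlk⟩ := H.exists_isFloquet_conjTransform hper hsymm hz hF.ne hl
  have hln : cauchyTransform ν (P (n + K + 1)) z = l * cauchyTransform ν (P (n + 1)) z := hl n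
  have hkn : conjTransform hν P (n + K + 1) z = k * conjTransform hν P (n + 1) z := hk n
  have hGK := H.two_mul_greenDiag hz (n + K + 1)
  rw [hln, hkn, mul_mul_mul_comm, hlk,
    H.cauchyTransform_mul_conjTransform hz] at hGK
  have hpos : 0 < ∏ i ∈ range K, jacobiA hν.momentFunctional P (i + 1) :=
    prod_pos fun i _ => H.jacobiA_pos _
  have := mul_pos hpos (sub_pos.2 hlt)
  refine neg_of_mul_pos_right ?_ (show 2 * cauchyTransform ν (P 0) z ≤ 0 by linarith)
  rw [hGK]
  positivity

lemma cauchyTransform_add_ne_zero (hz : z ∉ E) (hF : cauchyTransform ν (P 0) z ≠ 0)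
    (hn : cauchyTransform ν (P (n + 1)) z ≠ 0) : cauchyTransform ν (P (n + K + 1)) z ≠ 0 := by
  obtain ⟨l, hl, -⟩ := H.exists_isFloquet_cauchyTransform hper hz
  obtain ⟨k, -, hlk⟩ := H.exists_isFloquet_conjTransform hper hsymm hz hF hl
  have hpos : 0 < ∏ i ∈ range K, jacobiA hν.momentFunctional P (i + 1) :=
    prod_pos fun i _ => H.jacobiA_pos _
  have hln : cauchyTransform ν (P (n + K + 1)) z = l * cauchyTransform ν (P (n + 1)) z := hl n
  rw [hln]
  exact mul_ne_zero (left_ne_zero_of_mul (hlk.trans_ne hpos.ne')) hn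

end Conj

lemma cauchyTransform_neg_of_mem_gap (H : IsMonicOrthogonal hν.momentFunctional P)
    (hgap : Set.Ioo a b ⊆ Eᶜ)
    (hF : ∀ z ∈ Set.Ioo a b, cauchyTransform ν (P 0) z ^ 2 * D.eval z = N.eval z)
    (hNa : N.eval a = 0) (hDa : D.eval a ≠ 0) (hz : z ∈ Set.Ioo a b) :
    cauchyTransform ν (P 0) z < 0 := by
  have hanti : StrictAntiOn (cauchyTransform ν (P 0)) (Set.Ioo a b) := by
    simpa [greenDiag, H.zero_eq_one, StrictAntiOn] using H.strictAntiOn_greenDiag hgap 0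
  obtain ⟨w, haw, hwz⟩ := exists_between hz.1
  have hw : w ∈ Set.Ioo a b := ⟨haw, hwz.trans hz.2⟩
  refine (hanti hw hz hwz).trans_le
    (ge_of_tendsto (tendsto_zero_of_sq_mul_eval_eq hF (hz.1.trans hz.2) hNa hDa) ?_)
  filter_upwards [Ioo_mem_nhdsGT haw] with x hx
  exact (hanti ⟨hx.1, hx.2.trans hw.2⟩ hw hx.2).le

lemma exists_eval_add_period_eq_zero (H : IsMonicOrthogonal hν.momentFunctional P)
    (hper : HasPeriodicJacobi hν.momentFunctional P K) {x : ℝ}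
    (hodd : Odd ((N * D).rootMultiplicity x))
    (hF : ∀ᶠ z in atTop, cauchyTransform ν (P 0) z ^ 2 * D.eval z = N.eval z)
    (hgap : Set.Ioo a b ⊆ Eᶜ) (hNa : N.eval a = 0) (hDa : D.eval a ≠ 0) (hNb : N.eval b ≠ 0)
    (hDb : D.eval b = 0) (hy : y ∈ Set.Ioo a b) (hPy : (P n).eval y = 0) :
    ∃ z ∈ Set.Ioo a b, (P (n + K)).eval z = 0 := by
  obtain _ | n := n
  · simp [H.zero_eq_one] at hPy
  have hsymm := H.shiftCasoratian_secondKind_symm hper hodd hF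
  have hFgap : ∀ z ∈ Set.Ioo a b, cauchyTransform ν (P 0) z ^ 2 * D.eval z = N.eval z :=
    fun z hz => H.cauchyTransform_sq_mul_eval hper hodd hF (hgap hz)
  have hneg : ∀ z ∈ Set.Ioo a b, cauchyTransform ν (P 0) z < 0 :=
    fun z hz => H.cauchyTransform_neg_of_mem_gap hgap hFgap hNa hDa hz
  have hanti := H.strictAntiOn_greenDiag hgap (n + 1)
  have hGy : greenDiag ν (P (n + 1)) y = 0 := by rw [greenDiag, hPy, zero_mul]
  obtain ⟨c, hac, hcy⟩ := exists_between hy.1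
  have hc : c ∈ Set.Ioo a b := ⟨hac, hcy.trans hy.2⟩
  have hGc : 0 < greenDiag ν (P (n + K + 1)) c := by
    refine lt_of_lt_of_le (mul_pos (prod_pos fun i _ => H.jacobiA_pos _) ?_)
      (H.mul_greenDiag_le_greenDiag_add hper hsymm (hgap hc) (hneg c hc) n)
    rw [← hGy]
    exact hanti hc hy hcy
  have hPb : (P (n + 1)).eval b ≠ 0 := H.eval_right_ne_zero_of_mem_gap hgap hy hPy
  obtain ⟨d, hdlt, hcd, hdb⟩ := ((eventually_eval_sq_lt_sq_mul_eval_sq hFgap (hy.1.trans hy.2)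
    hNb hDb hPb (secondKind hν.momentFunctional P (n + 1))).and (Ioo_mem_nhdsLT hc.2)).exists
  have hd : d ∈ Set.Ioo a b := ⟨hac.trans hcd, hdb⟩
  have hGd := H.greenDiag_add_neg hper hsymm (hgap hd) (hneg d hd) hdlt
  obtain ⟨z, hz, hGz⟩ := intermediate_value_Icc' hcd.le ((hν.continuousOn_greenDiag _).mono
    ((Set.Icc_subset_Ioo hac hdb).trans hgap)) ⟨hGd.le, hGc.le⟩
  have hzab : z ∈ Set.Ioo a b := Set.Icc_subset_Ioo hac hdb hz
  refine ⟨z, hzab, ?_⟩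
  rw [add_right_comm]
  refine (mul_eq_zero.1 hGz).resolve_right (H.cauchyTransform_add_ne_zero hper hsymm (hgap hzab)
    (hneg z hzab).ne ?_)
  exact H.cauchyTransform_ne_zero_of_mem_gap hgap hy hPy hzab

end IsMonicOrthogonal

end Comparison

section LogPrimitive

/-- A primitive of `t ↦ log ((1 + t²) / (s² + t²))`. At `s = 0` the last term vanishes, because
`t / 0 = 0`. -/
noncomputable def logPrimitive (s t : ℝ) : ℝ :=
  t * Real.log (1 + t ^ 2) - t * Real.log (s ^ 2 + t ^ 2) + 2 * Real.arctan t -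
    2 * (s * Real.arctan (t / s))

variable {s t : ℝ}

lemma logPrimitive_zero : logPrimitive s 0 = 0 := by simp [logPrimitive]

lemma hasDerivAt_logPrimitive (ht : 0 < t) :
    HasDerivAt (logPrimitive s) (Real.log ((1 + t ^ 2) / (s ^ 2 + t ^ 2))) t := by
  have one_add_ne : 1 + t ^ 2 ≠ 0 := by positivity
  have sq_add_ne : s ^ 2 + t ^ 2 ≠ 0 := by positivity
  have deriv_sq (c : ℝ) : HasDerivAt (fun t : ℝ => c + t ^ 2) (2 * t) t := by
    simpa using (hasDerivAt_pow 2 t).const_add c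
  have deriv_arctan :
      HasDerivAt (fun t : ℝ => s * Real.arctan (t / s)) (s ^ 2 / (s ^ 2 + t ^ 2)) t := by
    rcases eq_or_ne s 0 with rfl | hs
    · simpa using hasDerivAt_const t (0 : ℝ)
    · refine ((((hasDerivAt_id t).div_const s).arctan).const_mul s).congr_deriv ?_
      simp only [id]
      field_simp
  refine (((((hasDerivAt_id t).mul ((deriv_sq 1).log one_add_ne)).sub
    ((hasDerivAt_id t).mul ((deriv_sq (s ^ 2)).log sq_add_ne))).add
    ((Real.hasDerivAt_arctan t).const_mul 2)).sub (deriv_arctan.const_mul 2)).congr_deriv ?_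
  rw [Real.log_div one_add_ne sq_add_ne]
  simp only [id]
  field_simp
  ring

lemma continuous_logPrimitive (s : ℝ) : Continuous (logPrimitive s) := by
  have continuous_log_one_add : Continuous fun t : ℝ => Real.log (1 + t ^ 2) :=
    Continuous.log (by fun_prop) fun t => by positivity
  have continuous_mul_log : Continuous fun t : ℝ => t * Real.log (s ^ 2 + t ^ 2) := by
    rcases eq_or_ne s 0 with rfl | hs
    · convert Real.continuous_mul_log.const_mul 2 using 2 with t
      rw [zero_pow two_ne_zero, zero_add, Real.log_pow]
      push_cast
      ring
    · exact continuous_id.mul (Continuous.log (by fun_prop) fun t => by positivity)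
  have := Real.continuous_arctan
  unfold logPrimitive
  fun_prop

lemma log_div_nonneg (hs0 : 0 ≤ s) (hs1 : s ≤ 1) (ht : 0 < t) :
    0 ≤ Real.log ((1 + t ^ 2) / (s ^ 2 + t ^ 2)) := by
  refine Real.log_nonneg ?_
  rw [one_le_div (by positivity)]
  nlinarith

lemma log_div_le (ht : 0 < t) :
    Real.log ((1 + t ^ 2) / (s ^ 2 + t ^ 2)) ≤ 1 / t ^ 2 := by
  refine (Real.log_le_sub_one_of_pos (by positivity)).trans ?_
  rw [div_sub_one (by positivity), div_le_div_iff₀ (by positivity) (by positivity)]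
  nlinarith [mul_nonneg (sq_nonneg s) (sq_nonneg t), sq_nonneg s]

lemma tendsto_logPrimitive (hs0 : 0 ≤ s) (hs1 : s ≤ 1) :
    Tendsto (logPrimitive s) atTop (𝓝 (Real.pi * (1 - s))) := by
  have tendsto_log_terms :
      Tendsto (fun t => t * Real.log (1 + t ^ 2) - t * Real.log (s ^ 2 + t ^ 2)) atTop (𝓝 0) := by
    have eq_mul_log_div : (fun t => t * Real.log ((1 + t ^ 2) / (s ^ 2 + t ^ 2))) =ᶠ[atTop]
        fun t => t * Real.log (1 + t ^ 2) - t * Real.log (s ^ 2 + t ^ 2) := by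
      filter_upwards [eventually_gt_atTop 0] with t ht
      rw [Real.log_div (by positivity) (by positivity), mul_sub]
    refine Tendsto.congr' eq_mul_log_div (tendsto_of_tendsto_of_tendsto_of_le_of_le'
      tendsto_const_nhds tendsto_inv_atTop_zero ?_ ?_)
    · filter_upwards [eventually_gt_atTop 0] with t ht
      exact mul_nonneg ht.le (log_div_nonneg hs0 hs1 ht)
    · filter_upwards [eventually_gt_atTop 0] with t ht
      calc t * _ ≤ t * (1 / t ^ 2) := mul_le_mul_of_nonneg_left (log_div_le ht) ht.le
        _ = t⁻¹ := by field_simp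
  have tendsto_arctan : Tendsto Real.arctan atTop (𝓝 (Real.pi / 2)) :=
    Real.tendsto_arctan_atTop.mono_right nhdsWithin_le_nhds
  have tendsto_mul_arctan :
      Tendsto (fun t => s * Real.arctan (t / s)) atTop (𝓝 (s * (Real.pi / 2))) := by
    rcases hs0.eq_or_lt with rfl | hs
    · simp
    · exact (tendsto_arctan.comp (tendsto_id.atTop_div_const hs)).const_mul s
  rw [show Real.pi * (1 - s) = 0 + 2 * (Real.pi / 2) - 2 * (s * (Real.pi / 2)) by ring]
  exact (tendsto_log_terms.add (tendsto_arctan.const_mul 2)).sub (tendsto_mul_arctan.const_mul 2)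

lemma lintegral_log_div (hs0 : 0 ≤ s) (hs1 : s ≤ 1) :
    ∫⁻ t in Set.Ioi (0 : ℝ), ENNReal.ofReal (Real.log ((1 + t ^ 2) / (s ^ 2 + t ^ 2))) =
      ENNReal.ofReal (Real.pi * (1 - s)) := by
  have continuousAt_zero :=
    (continuous_logPrimitive s).continuousWithinAt (s := Set.Ici 0) (x := 0)
  have hderiv : ∀ t ∈ Set.Ioi (0 : ℝ), HasDerivAt _ _ t := fun t ht =>
    hasDerivAt_logPrimitive (s := s) ht
  have hnonneg : ∀ t ∈ Set.Ioi (0 : ℝ), 0 ≤ Real.log ((1 + t ^ 2) / (s ^ 2 + t ^ 2)) :=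
    fun t ht => log_div_nonneg hs0 hs1 ht
  have hlim := tendsto_logPrimitive hs0 hs1
  rw [← ofReal_integral_eq_lintegral_ofReal
      (integrableOn_Ioi_deriv_of_nonneg continuousAt_zero hderiv hnonneg hlim)
      ((ae_restrict_iff' measurableSet_Ioi).2 (.of_forall hnonneg)),
    integral_Ioi_of_hasDerivAt_of_nonneg continuousAt_zero hderiv hnonneg hlim,
    logPrimitive_zero, sub_zero]

end LogPrimitive

section InterlacingQuotient

variable {ι : Type*} [Fintype ι] {p q x : ι → ℝ} {u z : ℝ}

/-- The quotient `∏ (x - q k) / (x - p k)` attached to the intervals `(p k, q k)`. -/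
noncomputable def interlacingQuotient (p q : ι → ℝ) (x : ℝ) : ℝ := ∏ k, (x - q k) / (x - p k)

/-- The points `x k`, one in each interval `(p k, q k)`, are the solutions of
`interlacingQuotient p q y = -u`; the equation is stated after clearing denominators. -/
structure IsLevelRoots (p q : ι → ℝ) (u : ℝ) (x : ι → ℝ) : Prop where
  mem : ∀ k, x k ∈ Set.Ioo (p k) (q k)
  prod_add : ∀ y, ∏ k, (y - q k) + u * ∏ k, (y - p k) = (1 + u) * ∏ k, (y - x k)

lemma measurable_interlacingQuotient : Measurable (interlacingQuotient p q) := by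
  unfold interlacingQuotient
  fun_prop

lemma interlacingQuotient_nonneg (hpq : ∀ k, p k < q k) (hz : ∀ k, q k ≤ z) :
    0 ≤ interlacingQuotient p q z :=
  prod_nonneg fun k _ => div_nonneg (by linarith [hz k]) (by linarith [hz k, hpq k])

lemma interlacingQuotient_le_one (hpq : ∀ k, p k < q k) (hz : ∀ k, q k ≤ z) :
    interlacingQuotient p q z ≤ 1 := by
  refine prod_le_one (fun k _ => div_nonneg (by linarith [hz k]) (by linarith [hz k, hpq k]))
    fun k _ => ?_
  rw [div_le_one (by linarith [hz k, hpq k])]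
  linarith [hpq k]

lemma prod_add_eq_of_roots (hx : Function.Injective x)
    (hroot : ∀ k, ∏ j, (x k - q j) + u * ∏ j, (x k - p j) = 0) (y : ℝ) :
    ∏ k, (y - q k) + u * ∏ k, (y - p k) = (1 + u) * ∏ k, (y - x k) := by
  have degree_lt (a : ι → ℝ) :
      (∏ k, (X - C (a k)) - ∏ k, (X - C (x k))).degree < (#(univ : Finset ι) : WithBot ℕ) := by
    have hmonic (a : ι → ℝ) : (∏ k, (X - C (a k))).Monic :=
      monic_prod_of_monic _ _ fun k _ => monic_X_sub_C _
    have hdegree (a : ι → ℝ) : (∏ k, (X - C (a k))).natDegree = #(univ : Finset ι) := by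
      simp [natDegree_prod_of_monic _ _ fun k _ => monic_X_sub_C (a k)]
    exact degree_sub_lt_of_monic (hmonic a) (hmonic x) (hdegree a) (hdegree x)
  have difference_eq_zero : (∏ k, (X - C (q k)) - ∏ k, (X - C (x k))) +
      u • (∏ k, (X - C (p k)) - ∏ k, (X - C (x k))) = 0 := by
    refine eq_zero_of_degree_lt_of_eval_index_eq_zero (s := univ) (v := x) hx.injOn
      ((degree_add_le _ _).trans_lt
        (max_lt (degree_lt q) ((degree_smul_le _ _).trans_lt (degree_lt p)))) fun k _ => ?_
    simp only [eval_add, eval_sub, eval_smul, smul_eq_mul, eval_C, eval_prod,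
      eval_X, prod_eq_zero (mem_univ k) (f := fun j => x k - x j) (sub_self _), sub_zero]
    exact hroot k
  have eval_difference := congrArg (eval y) difference_eq_zero
  simp only [eval_add, eval_sub, eval_smul, smul_eq_mul, eval_C, eval_prod, eval_X,
    eval_zero] at eval_difference
  linarith

lemma IsLevelRoots.interlacingQuotient_add (hx : IsLevelRoots p q u x) {y : ℝ} (hy : ∀ k, y ≠ p k) :
    interlacingQuotient p q y + u = (1 + u) * ∏ k, (y - x k) / (y - p k) := by
  have hprod : ∏ k, (y - p k) ≠ 0 := prod_ne_zero_iff.2 fun k _ => sub_ne_zero.2 (hy k)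
  rw [interlacingQuotient, prod_div_distrib, prod_div_distrib, ← mul_div_assoc, ← hx.prod_add y,
    add_div, mul_div_cancel_right₀ _ hprod]

end InterlacingQuotient

section IntervalChain

variable {ι : Type*} [LinearOrder ι] {p q x : ι → ℝ} {u t : ℝ}

/-- The intervals `[p k, q k]` are nondegenerate, pairwise disjoint, and listed from left to
right. -/
structure IsIntervalChain (p q : ι → ℝ) : Prop where
  lt : ∀ k, p k < q k
  right_lt_left : ∀ ⦃j k⦄, j < k → q j < p k

namespace IsIntervalChain

lemma strictMono_left (h : IsIntervalChain p q) : StrictMono p :=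
  fun j _ hjk => (h.lt j).trans (h.right_lt_left hjk)

lemma strictMono_right (h : IsIntervalChain p q) : StrictMono q :=
  fun _ k hjk => (h.right_lt_left hjk).trans (h.lt k)

lemma mul_sub_pos (h : IsIntervalChain p q) {j k : ι} (hjk : j ≠ k) {a b c d : ℝ}
    (ha : a ∈ Set.Icc (p j) (q j)) (hb : b ∈ Set.Icc (p j) (q j))
    (hc : c ∈ Set.Icc (p k) (q k)) (hd : d ∈ Set.Icc (p k) (q k)) :
    0 < (c - a) * (d - b) := by
  rcases hjk.lt_or_gt with hlt | hgt
  · have := h.right_lt_left hlt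
    exact mul_pos (by linarith [ha.2, hc.1]) (by linarith [hb.2, hd.1])
  · have := h.right_lt_left hgt
    exact mul_pos_of_neg_of_neg (by linarith [ha.1, hc.2]) (by linarith [hb.1, hd.2])

lemma ne_of_mem (h : IsIntervalChain p q) {j k : ι} (hjk : j ≠ k) {a c : ℝ}
    (ha : a ∈ Set.Icc (p j) (q j)) (hc : c ∈ Set.Icc (p k) (q k)) : c ≠ a := fun hca =>
  (h.mul_sub_pos hjk ha ha hc hc).ne' (by rw [hca, sub_self, zero_mul])

lemma left_mem (h : IsIntervalChain p q) (k : ι) : p k ∈ Set.Icc (p k) (q k) :=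
  Set.left_mem_Icc.2 (h.lt k).le

lemma right_mem (h : IsIntervalChain p q) (k : ι) : q k ∈ Set.Icc (p k) (q k) :=
  Set.right_mem_Icc.2 (h.lt k).le

end IsIntervalChain

variable [Fintype ι]

lemma exists_mem_Ioo_prod_add_eq_zero (h : IsIntervalChain p q) (hu : 0 < u) (k : ι) :
    ∃ y ∈ Set.Ioo (p k) (q k), ∏ j, (y - q j) + u * ∏ j, (y - p j) = 0 := by
  set f : ℝ → ℝ := fun y => ∏ j, (y - q j) + u * ∏ j, (y - p j) with hf
  have f_continuous : ContinuousOn f (Set.Icc (p k) (q k)) := by fun_prop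
  have f_left : f (p k) = ∏ j, (p k - q j) := by
    simp only [hf, prod_eq_zero (mem_univ k) (f := fun j => p k - p j) (sub_self _), mul_zero,
      add_zero]
  have f_right : f (q k) = u * ∏ j, (q k - p j) := by
    simp only [hf, prod_eq_zero (mem_univ k) (f := fun j => q k - q j) (sub_self _), zero_add]
  have f_mul_neg : f (p k) * f (q k) < 0 := by
    rw [f_left, f_right, mul_left_comm, ← prod_mul_distrib, ← mul_prod_erase _ _ (mem_univ k)]
    refine mul_neg_of_pos_of_neg hu (mul_neg_of_neg_of_pos ?_ (prod_pos fun j hj => ?_))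
    · exact mul_neg_of_neg_of_pos (sub_neg.2 (h.lt k)) (sub_pos.2 (h.lt k))
    · exact h.mul_sub_pos (ne_of_mem_erase hj) (h.right_mem j) (h.left_mem j) (h.left_mem k)
        (h.right_mem k)
  rcases mul_neg_iff.1 f_mul_neg with ⟨hp, hq⟩ | ⟨hp, hq⟩
  · exact intermediate_value_Ioo' (h.lt k).le f_continuous ⟨hq, hp⟩
  · exact intermediate_value_Ioo (h.lt k).le f_continuous ⟨hp, hq⟩

lemma exists_isLevelRoots (h : IsIntervalChain p q) (hu : 0 < u) : ∃ x, IsLevelRoots p q u x := by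
  choose x hx hroot using exists_mem_Ioo_prod_add_eq_zero h hu
  have x_strictMono : StrictMono x := fun j k hjk =>
    (hx j).2.trans ((h.right_lt_left hjk).trans (hx k).1)
  exact ⟨x, hx, prod_add_eq_of_roots x_strictMono.injective hroot⟩

namespace IsLevelRoots

lemma interlacingQuotient_add_neg_iff (h : IsIntervalChain p q) (hu : 0 < u)
    (hx : IsLevelRoots p q u x) {k : ι} {y : ℝ} (hy : y ∈ Set.Ioo (p k) (q k)) :
    interlacingQuotient p q y + u < 0 ↔ y < x k := by
  have hyk : y ∈ Set.Icc (p k) (q k) := Set.Ioo_subset_Icc_self hy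
  have ne_left (j : ι) : y ≠ p j := by
    rcases eq_or_ne j k with rfl | hjk
    · exact hy.1.ne'
    · exact h.ne_of_mem hjk (h.left_mem j) hyk
  have other_factors_pos : 0 < ∏ j ∈ univ.erase k, (y - x j) / (y - p j) :=
    prod_pos fun j hj => div_pos_iff.2 (mul_pos_iff.1 (h.mul_sub_pos (ne_of_mem_erase hj)
      (Set.Ioo_subset_Icc_self (hx.mem j)) (h.left_mem j) hyk hyk))
  have left_pos : 0 < y - p k := sub_pos.2 hy.1
  have factorization : interlacingQuotient p q y + u =
      (1 + u) * (∏ j ∈ univ.erase k, (y - x j) / (y - p j)) / (y - p k) * (y - x k) := by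
    rw [hx.interlacingQuotient_add ne_left, ← mul_prod_erase _ _ (mem_univ k)]
    ring
  rw [factorization, ← smul_eq_mul, smul_neg_iff_of_pos_left (by positivity), sub_neg]

lemma superlevel_inter_eq (h : IsIntervalChain p q) (ht : 0 < t)
    (hx : IsLevelRoots p q (t ^ 2) x) :
    {y | t < √(-interlacingQuotient p q y)} ∩ ⋃ k, Set.Ioo (p k) (q k) =
      ⋃ k, Set.Ioo (p k) (x k) := by
  have mem_iff {k : ι} {y : ℝ} (hy : y ∈ Set.Ioo (p k) (q k)) :
      t < √(-interlacingQuotient p q y) ↔ y < x k := by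
    rw [← hx.interlacingQuotient_add_neg_iff h (pow_pos ht 2) hy, Real.lt_sqrt ht.le, add_comm,
      lt_neg_iff_add_neg]
  ext y
  simp only [Set.mem_inter_iff, Set.mem_ofPred_eq, Set.mem_iUnion]
  constructor
  · rintro ⟨hlt, k, hk⟩
    exact ⟨k, hk.1, (mem_iff hk).1 hlt⟩
  · rintro ⟨k, hk⟩
    have hkq : y ∈ Set.Ioo (p k) (q k) := ⟨hk.1, hk.2.trans (hx.mem k).2⟩
    exact ⟨(mem_iff hkq).2 hk.2, k, hkq⟩

end IsLevelRoots

end IntervalChain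

section LayerCake

variable {ι : Type*} [LinearOrder ι] [Fintype ι] {p q x : ι → ℝ} {u z : ℝ}

lemma lintegral_inv_sub {a b : ℝ} (hab : a < b) (hbz : b < z) :
    ∫⁻ x in Set.Ioo a b, ENNReal.ofReal (z - x)⁻¹ =
      ENNReal.ofReal (Real.log ((z - a) / (z - b))) := by
  have sub_pos_of_mem : ∀ x ∈ Set.Icc a b, 0 < z - x := fun x hx => by linarith [hx.2]
  have hcont : ContinuousOn (fun x => (z - x)⁻¹) (Set.Icc a b) :=
    ContinuousOn.inv₀ (by fun_prop) fun x hx => (sub_pos_of_mem x hx).ne'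
  have hderiv : ∀ x ∈ Set.uIcc a b, HasDerivAt (fun x => -Real.log (z - x)) (z - x)⁻¹ x := by
    intro x hx
    rw [Set.uIcc_of_le hab.le] at hx
    refine ((((hasDerivAt_id x).const_sub z).log (sub_pos_of_mem x hx).ne').neg).congr_deriv ?_
    simp [neg_div]
  have hint : IntervalIntegrable (fun x => (z - x)⁻¹) volume a b :=
    ContinuousOn.intervalIntegrable (by rwa [Set.uIcc_of_le hab.le])
  rw [← ofReal_integral_eq_lintegral_ofReal
      (hcont.integrableOn_Icc.mono_set Set.Ioo_subset_Icc_self)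
      ((ae_restrict_iff' measurableSet_Ioo).2 (.of_forall fun x hx =>
        (inv_pos.2 (sub_pos_of_mem x (Set.Ioo_subset_Icc_self hx))).le)),
    ← integral_Ioc_eq_integral_Ioo, ← intervalIntegral.integral_of_le hab.le,
    intervalIntegral.integral_eq_sub_of_hasDerivAt hderiv hint,
    Real.log_div (by linarith) (by linarith), neg_sub_neg]

lemma IsLevelRoots.lintegral_inv_sub_iUnion (h : IsIntervalChain p q) (hu : 0 < u)
    (hz : ∀ k, q k ≤ z) (hx : IsLevelRoots p q u x) :
    ∫⁻ y in ⋃ k, Set.Ioo (p k) (x k), ENNReal.ofReal (z - y)⁻¹ =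
      ENNReal.ofReal (Real.log ((1 + u) / (interlacingQuotient p q z + u))) := by
  have hxz (k : ι) : 0 < z - x k := sub_pos.2 ((hx.mem k).2.trans_le (hz k))
  have hpz (k : ι) : 0 < z - p k := sub_pos.2 ((h.lt k).trans_le (hz k))
  have hdisj : Pairwise (Function.onFun Disjoint fun k => Set.Ioo (p k) (x k)) :=
    fun j k hjk => Set.disjoint_left.2 fun y hyj hyk => h.ne_of_mem hjk
      ⟨hyj.1.le, (hyj.2.trans (hx.mem j).2).le⟩ ⟨hyk.1.le, (hyk.2.trans (hx.mem k).2).le⟩ rfl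
  have log_nonneg (k : ι) : 0 ≤ Real.log ((z - p k) / (z - x k)) := by
    refine Real.log_nonneg ((one_le_div (hxz k)).2 ?_)
    linarith [(hx.mem k).1]
  rw [lintegral_iUnion (fun k => measurableSet_Ioo) hdisj, tsum_fintype,
    sum_congr rfl fun k _ => lintegral_inv_sub (hx.mem k).1 (sub_pos.1 (hxz k)),
    ← ENNReal.ofReal_sum_of_nonneg fun k _ => log_nonneg k,
    ← Real.log_prod fun k _ => (div_pos (hpz k) (hxz k)).ne',
    hx.interlacingQuotient_add fun k => (sub_pos.1 (hpz k)).ne',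
    div_mul_cancel_left₀ (by positivity), ← prod_inv_distrib]
  simp only [inv_div]

lemma lintegral_sqrt_interlacingQuotient (h : IsIntervalChain p q) (hz : ∀ k, q k ≤ z) :
    ∫⁻ x in ⋃ k, Set.Ioo (p k) (q k),
      ENNReal.ofReal (z - x)⁻¹ * ENNReal.ofReal √(-interlacingQuotient p q x) =
    ENNReal.ofReal (Real.pi * (1 - √(interlacingQuotient p q z))) := by
  have inv_measurable : Measurable fun x => ENNReal.ofReal (z - x)⁻¹ := by fun_prop
  have sqrt_measurable : Measurable fun x => √(-interlacingQuotient p q x) :=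
    measurable_interlacingQuotient.neg.sqrt
  have layer_measurable (t : ℝ) : MeasurableSet {y | t < √(-interlacingQuotient p q y)} :=
    measurableSet_lt measurable_const sqrt_measurable
  have as_withDensity := lintegral_withDensity_eq_lintegral_mul
    (volume.restrict (⋃ k, Set.Ioo (p k) (q k))) inv_measurable sqrt_measurable.ennreal_ofReal
  simp only [Pi.mul_apply] at as_withDensity
  rw [← as_withDensity,
    lintegral_eq_lintegral_meas_lt _ (.of_forall fun x => Real.sqrt_nonneg _)
      sqrt_measurable.aemeasurable,
    ← lintegral_log_div (Real.sqrt_nonneg _)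
      (Real.sqrt_le_one.2 (interlacingQuotient_le_one h.lt hz)),
    Real.sq_sqrt (interlacingQuotient_nonneg h.lt hz)]
  refine setLIntegral_congr_fun measurableSet_Ioi fun t (ht : 0 < t) => ?_
  obtain ⟨x, hx⟩ := exists_isLevelRoots h (pow_pos ht 2)
  simp only [withDensity_apply _ (layer_measurable t),
    Measure.restrict_restrict (layer_measurable t), hx.superlevel_inter_eq h ht,
    hx.lintegral_inv_sub_iUnion h (pow_pos ht 2) hz]

end LayerCake

section Endpoints

variable {g : ℕ} {α β : Fin g → ℝ}

/-- The left endpoints `-1, β₁, …, β_g` of the bands. -/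
def leftEnd (β : Fin g → ℝ) : Fin (g + 1) → ℝ := Fin.cons (-1) β

/-- The right endpoints `α₁, …, α_g, 1` of the bands. -/
def rightEnd (α : Fin g → ℝ) : Fin (g + 1) → ℝ := Fin.snoc α 1

@[simp] lemma leftEnd_zero : leftEnd β 0 = -1 := rfl

@[simp] lemma leftEnd_succ (i : Fin g) : leftEnd β i.succ = β i := rfl

@[simp] lemma rightEnd_castSucc (i : Fin g) : rightEnd α i.castSucc = α i := by
  simp [rightEnd]

@[simp] lemma rightEnd_last : rightEnd α (Fin.last g) = 1 := by
  simp [rightEnd]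

lemma leftEnd_lt_rightEnd (hα : ∀ i, -1 < α i) (hβ : ∀ i, β i < 1)
    (hord : ∀ i j, i < j → β i < α j) (k : Fin (g + 1)) : leftEnd β k < rightEnd α k := by
  induction k using Fin.lastCases with
  | last =>
    rw [rightEnd_last]
    induction (Fin.last g) using Fin.cases with
    | zero => norm_num
    | succ i => exact hβ i
  | cast i =>
    rw [rightEnd_castSucc]
    rcases Fin.eq_zero_or_eq_succ i.castSucc with h | ⟨j, h⟩
    · rw [h, leftEnd_zero]
      exact hα i
    · rw [h, leftEnd_succ]
      refine hord j i ?_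
      rw [← Fin.castSucc_lt_castSucc_iff, h]
      exact Fin.castSucc_lt_succ

lemma rightEnd_lt_leftEnd (hgap : IsIntervalChain α β) {j k : Fin (g + 1)} (hjk : j < k) :
    rightEnd α j < leftEnd β k := by
  obtain ⟨k', rfl⟩ := Fin.eq_succ_of_ne_zero (Fin.ne_zero_of_lt hjk)
  obtain ⟨j', rfl⟩ := Fin.exists_castSucc_eq.2 (Fin.ne_last_of_lt hjk)
  rw [rightEnd_castSucc, leftEnd_succ]
  exact (hgap.strictMono_left.monotone (Fin.castSucc_lt_succ_iff.1 hjk)).trans_lt (hgap.lt k')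

lemma isIntervalChain_ends (hα : ∀ i, -1 < α i) (hβ : ∀ i, β i < 1)
    (hgap : IsIntervalChain α β) : IsIntervalChain (leftEnd β) (rightEnd α) where
  lt := leftEnd_lt_rightEnd hα hβ fun _ _ h => hgap.right_lt_left h
  right_lt_left _ _ := rightEnd_lt_leftEnd hgap

lemma bands_subset_iUnion : bands α β ⊆ ⋃ k, Set.Icc (leftEnd β k) (rightEnd α k) := by
  rintro x ⟨hx, hgaps⟩
  have exists_band (k : Fin (g + 1)) :
      leftEnd β k ≤ x → ∃ j, x ∈ Set.Icc (leftEnd β j) (rightEnd α j) := by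
    induction k using Fin.reverseInduction with
    | last => exact fun hle => ⟨Fin.last g, hle, by simpa using hx.2⟩
    | cast i ih =>
      intro hle
      by_cases hxα : x ≤ α i
      · exact ⟨i.castSucc, hle, by simpa using hxα⟩
      · exact ih (not_lt.1 fun hxβ => hgaps (Set.mem_iUnion.2 ⟨i, not_le.1 hxα, hxβ⟩))
  exact Set.mem_iUnion.2 (exists_band 0 hx.1)

lemma rightEnd_le_one (hα : ∀ i, -1 < α i) (hβ : ∀ i, β i < 1) (hgap : IsIntervalChain α β)
    (k : Fin (g + 1)) : rightEnd α k ≤ 1 :=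
  ((isIntervalChain_ends hα hβ hgap).strictMono_right.monotone (Fin.le_last k)).trans_eq
    rightEnd_last

lemma iUnion_subset_bands (hα : ∀ i, -1 < α i) (hβ : ∀ i, β i < 1) (hgap : IsIntervalChain α β) :
    ⋃ k, Set.Icc (leftEnd β k) (rightEnd α k) ⊆ bands α β := by
  have hends := isIntervalChain_ends hα hβ hgap
  refine Set.iUnion_subset fun k x hx => ⟨⟨?_, hx.2.trans (rightEnd_le_one hα hβ hgap k)⟩, ?_⟩
  · exact (hends.strictMono_left.monotone (Fin.zero_le k)).trans hx.1
  · rw [Set.mem_iUnion]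
    rintro ⟨i, hi⟩
    rcases lt_or_ge i.castSucc k with hlt | hge
    · have right_le : β i ≤ leftEnd β k :=
        hends.strictMono_left.monotone (Fin.castSucc_lt_iff_succ_le.1 hlt)
      exact hi.2.not_ge (right_le.trans hx.1)
    · have le_left : rightEnd α k ≤ α i :=
        (hends.strictMono_right.monotone hge).trans_eq (rightEnd_castSucc i)
      exact hi.1.not_ge (hx.2.trans le_left)

lemma bands_ae_eq_iUnion (hα : ∀ i, -1 < α i) (hβ : ∀ i, β i < 1) (hgap : IsIntervalChain α β) :
    (bands α β : Set ℝ) =ᵐ[volume] ⋃ k, Set.Ioo (leftEnd β k) (rightEnd α k) := by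
  rw [bands_subset_iUnion.antisymm (iUnion_subset_bands hα hβ hgap)]
  exact Filter.EventuallyEq.countable_iUnion fun k => Ioo_ae_eq_Icc.symm

lemma interlacingQuotient_ends (x : ℝ) : interlacingQuotient (leftEnd β) (rightEnd α) x =
    (∏ i, (x - α i)) * (x - 1) / ((x + 1) * ∏ i, (x - β i)) := by
  rw [interlacingQuotient, prod_div_distrib, Fin.prod_univ_castSucc, Fin.prod_univ_succ]
  simp

lemma weight_eq {x : ℝ} (hx : x < 1) : weight α β x = 1 / Real.pi *
    ((1 - x)⁻¹ * √(-interlacingQuotient (leftEnd β) (rightEnd α) x)) := by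
  have one_sub_pos : 0 < 1 - x := by linarith
  have radicand_eq : (∏ i, (x - α i)) / ((1 - x ^ 2) * ∏ i, (x - β i)) =
      -interlacingQuotient (leftEnd β) (rightEnd α) x / (1 - x) ^ 2 := by
    rw [interlacingQuotient_ends, show 1 - x ^ 2 = (1 - x) * (x + 1) by ring]
    field_simp
    ring
  rw [weight, radicand_eq, Real.sqrt_div' _ (sq_nonneg _), Real.sqrt_sq one_sub_pos.le]
  ring

end Endpoints

section StieltjesTransform

variable {g : ℕ} {α β : Fin g → ℝ}

lemma measurableSet_bands : MeasurableSet (bands α β) :=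
  measurableSet_Icc.diff (.iUnion fun _ => measurableSet_Ioo)

lemma integral_sqrt_interlacingQuotient (hα : ∀ i, -1 < α i) (hβ : ∀ i, β i < 1)
    (hgap : IsIntervalChain α β) {z : ℝ} (hz : 1 ≤ z) :
    IntegrableOn (fun x => (z - x)⁻¹ * √(-interlacingQuotient (leftEnd β) (rightEnd α) x))
      (bands α β) ∧
    ∫ x in bands α β, (z - x)⁻¹ * √(-interlacingQuotient (leftEnd β) (rightEnd α) x) =
      Real.pi * (1 - √(interlacingQuotient (leftEnd β) (rightEnd α) z)) := by
  set r := interlacingQuotient (leftEnd β) (rightEnd α) with hr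
  have hends := isIntervalChain_ends hα hβ hgap
  have right_le : ∀ k, rightEnd α k ≤ z := fun k => (rightEnd_le_one hα hβ hgap k).trans hz
  have inv_nonneg : ∀ᵐ x ∂volume.restrict (bands α β), 0 ≤ (z - x)⁻¹ :=
    (ae_restrict_iff' measurableSet_bands).2
      (.of_forall fun x hx => inv_nonneg.2 (by linarith [hx.1.2]))
  have integrand_measurable : Measurable fun x => (z - x)⁻¹ * √(-r x) :=
    Measurable.mul (by fun_prop) measurable_interlacingQuotient.neg.sqrt
  have integrand_nonneg : 0 ≤ᵐ[volume.restrict (bands α β)] fun x => (z - x)⁻¹ * √(-r x) := by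
    filter_upwards [inv_nonneg] with x hx using mul_nonneg hx (Real.sqrt_nonneg _)
  have lintegral_eq : ∫⁻ x in bands α β, ENNReal.ofReal ((z - x)⁻¹ * √(-r x)) =
      ENNReal.ofReal (Real.pi * (1 - √(r z))) := by
    rw [hr, ← lintegral_sqrt_interlacingQuotient hends right_le,
      ← setLIntegral_congr (bands_ae_eq_iUnion hα hβ hgap)]
    refine lintegral_congr_ae ?_
    filter_upwards [inv_nonneg] with x hx using ENNReal.ofReal_mul hx
  refine ⟨⟨integrand_measurable.aestronglyMeasurable, ?_⟩, ?_⟩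
  · rw [hasFiniteIntegral_iff_ofReal integrand_nonneg, lintegral_eq]
    exact ENNReal.ofReal_lt_top
  · rw [integral_eq_lintegral_of_nonneg_ae integrand_nonneg
      integrand_measurable.aestronglyMeasurable, lintegral_eq, ENNReal.toReal_ofReal]
    exact mul_nonneg Real.pi_pos.le
      (sub_nonneg.2 (Real.sqrt_le_one.2 (interlacingQuotient_le_one hends.lt right_le)))

lemma ae_mem_bands_lt_one : ∀ᵐ x ∂volume.restrict (bands α β), x < 1 := by
  have ne_one : ∀ᵐ x ∂volume.restrict (bands α β), x ≠ 1 :=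
    ae_restrict_of_ae (by simp [ae_iff])
  filter_upwards [ne_one, ae_restrict_mem measurableSet_bands] with x hne hx
  exact lt_of_le_of_ne hx.1.2 hne

lemma weight_ae_eq : weight α β =ᵐ[volume.restrict (bands α β)] fun x =>
    1 / Real.pi * ((1 - x)⁻¹ * √(-interlacingQuotient (leftEnd β) (rightEnd α) x)) := by
  filter_upwards [ae_mem_bands_lt_one] with x hx using weight_eq hx

lemma integrableOn_weight_of_isIntervalChain (hα : ∀ i, -1 < α i) (hβ : ∀ i, β i < 1)
    (hgap : IsIntervalChain α β) : IntegrableOn (weight α β) (bands α β) :=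
  (integrable_congr weight_ae_eq).2
    ((integral_sqrt_interlacingQuotient hα hβ hgap le_rfl).1.const_mul _)

lemma integral_weight_mul_inv_of_isIntervalChain (hα : ∀ i, -1 < α i) (hβ : ∀ i, β i < 1)
    (hgap : IsIntervalChain α β) {z : ℝ} (hz : 1 < z) :
    ∫ x in bands α β, weight α β x * (z - x)⁻¹ =
      √(interlacingQuotient (leftEnd β) (rightEnd α) z) / (z - 1) := by
  set r := interlacingQuotient (leftEnd β) (rightEnd α) with hr
  obtain ⟨integrable_one, integral_one⟩ :=
    integral_sqrt_interlacingQuotient hα hβ hgap le_rfl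
  obtain ⟨integrable_z, integral_z⟩ :=
    integral_sqrt_interlacingQuotient hα hβ hgap hz.le
  have r_one : r 1 = 0 := by simp [hr, interlacingQuotient_ends]
  have sub_one_ne : z - 1 ≠ 0 := by linarith
  have partial_fractions :
      (fun x => weight α β x * (z - x)⁻¹) =ᵐ[volume.restrict (bands α β)] fun x =>
        1 / Real.pi * (z - 1)⁻¹ * ((1 - x)⁻¹ * √(-r x) - (z - x)⁻¹ * √(-r x)) := by
    filter_upwards [ae_mem_bands_lt_one, weight_ae_eq] with x hx hwx
    have one_sub_ne : 1 - x ≠ 0 := by linarith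
    have sub_ne : z - x ≠ 0 := by linarith
    rw [hwx]
    field_simp
    ring
  rw [integral_congr_ae partial_fractions, integral_const_mul,
    integral_sub integrable_one integrable_z, integral_one, integral_z, ← hr, r_one,
    Real.sqrt_zero]
  have := Real.pi_pos
  field_simp
  ring

lemma sq_integral_weight_mul_inv_of_isIntervalChain (hα : ∀ i, -1 < α i) (hβ : ∀ i, β i < 1)
    (hgap : IsIntervalChain α β) {z : ℝ} (hz : 1 < z) :
    (∫ x in bands α β, weight α β x * (z - x)⁻¹) ^ 2 =
      (∏ i, (z - α i)) / ((z ^ 2 - 1) * ∏ i, (z - β i)) := by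
  have r_nonneg : 0 ≤ interlacingQuotient (leftEnd β) (rightEnd α) z :=
    interlacingQuotient_nonneg (isIntervalChain_ends hα hβ hgap).lt
      fun k => (rightEnd_le_one hα hβ hgap k).trans hz.le
  have sub_one_ne : z - 1 ≠ 0 := by linarith
  rw [integral_weight_mul_inv_of_isIntervalChain hα hβ hgap hz, div_pow, Real.sq_sqrt r_nonneg,
    interlacingQuotient_ends, show z ^ 2 - 1 = (z - 1) * (z + 1) by ring]
  field_simp

lemma bands_succAbove {α β : Fin (g + 1) → ℝ} {i : Fin (g + 1)} (h : α i = β i) :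
    bands (α ∘ i.succAbove) (β ∘ i.succAbove) = bands α β := by
  ext x
  have not_mem_gap : x ∉ Set.Ioo (α i) (β i) := by simp [h]
  simp [bands, Fin.forall_iff_succAbove i, not_mem_gap, -Set.mem_Ioo]

lemma weight_succAbove_ae {α β : Fin (g + 1) → ℝ} {i : Fin (g + 1)} (h : α i = β i) :
    weight (α ∘ i.succAbove) (β ∘ i.succAbove) =ᵐ[volume] weight α β := by
  have ne_endpoint : ∀ᵐ x : ℝ, x ≠ β i := by simp [ae_iff]
  filter_upwards [ne_endpoint] with x hx
  simp only [weight, Fin.prod_univ_succAbove _ i, h, Function.comp]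
  rw [mul_left_comm, mul_div_mul_left _ _ (sub_ne_zero.2 hx)]

/-- Closed gaps change neither the bands nor, almost everywhere, the weight, so they are removed
one at a time. -/
lemma integrableOn_weight_and_sq_integral (hα : ∀ i, -1 < α i) (hαβ : ∀ i, α i ≤ β i)
    (hβ : ∀ i, β i < 1) (hord : ∀ i j, i < j → β i < α j) :
    IntegrableOn (weight α β) (bands α β) ∧
    ∀ z, 1 < z → (∫ x in bands α β, weight α β x * (z - x)⁻¹) ^ 2 =
      (∏ i, (z - α i)) / ((z ^ 2 - 1) * ∏ i, (z - β i)) := by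
  induction g with
  | zero =>
    have hgap : IsIntervalChain α β := ⟨fun i => i.elim0, fun i => i.elim0⟩
    exact ⟨integrableOn_weight_of_isIntervalChain hα hβ hgap,
      fun _ => sq_integral_weight_mul_inv_of_isIntervalChain hα hβ hgap⟩
  | succ g ih =>
    by_cases hopen : ∀ i, α i < β i
    · have hgap : IsIntervalChain α β := ⟨hopen, fun i j => hord i j⟩
      exact ⟨integrableOn_weight_of_isIntervalChain hα hβ hgap,
        fun _ => sq_integral_weight_mul_inv_of_isIntervalChain hα hβ hgap⟩
    push Not at hopen
    obtain ⟨i, hi⟩ := hopen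
    have closed_gap : α i = β i := (hαβ i).antisymm hi
    obtain ⟨integrable_removed, sq_removed⟩ := ih (α := α ∘ i.succAbove) (β := β ∘ i.succAbove)
      (fun k => hα _) (fun k => hαβ _) (fun k => hβ _)
      (fun j k hjk => hord _ _ (i.strictMono_succAbove hjk))
    have weight_eq := ae_restrict_of_ae (s := bands α β) (weight_succAbove_ae closed_gap)
    rw [bands_succAbove closed_gap] at integrable_removed sq_removed
    refine ⟨(integrable_congr weight_eq).1 integrable_removed, fun z hz => ?_⟩
    have integrand_eq : (fun x => weight α β x * (z - x)⁻¹) =ᵐ[volume.restrict (bands α β)]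
        fun x => weight (α ∘ i.succAbove) (β ∘ i.succAbove) x * (z - x)⁻¹ := by
      filter_upwards [weight_eq] with x hx
      rw [hx]
    rw [integral_congr_ae integrand_eq, sq_removed z hz]
    simp only [Fin.prod_univ_succAbove _ i, closed_gap, Function.comp]
    rw [mul_left_comm, mul_div_mul_left _ _ (by linarith [hβ i] : z - β i ≠ 0)]

end StieltjesTransform

section BandMeasure

lemma IsCompactCarrier.momentFunctional_mul_self_ne_zero {ν : Measure ℝ} {E : Set ℝ}
    [IsFiniteMeasure ν] [NullSingletonClass ν] (hν : IsCompactCarrier ν E) (hne : ν ≠ 0) {p : ℝ[X]}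
    (hp : p ≠ 0) : hν.momentFunctional (p * p) ≠ 0 := by
  rw [hν.momentFunctional_apply]
  intro h0
  rw [integral_eq_zero_iff_of_nonneg (fun x => by simpa using mul_self_nonneg (p.eval x))
    (hν.integrable_eval _)] at h0
  have ae_notRoot : ∀ᵐ x ∂ν, ¬ p.IsRoot x := by
    simpa [ae_iff] using (finite_setOfPred_isRoot hp).measure_zero ν
  refine hne (ae_eq_bot.1 (eventually_false_iff_eq_bot.1 ?_))
  filter_upwards [h0, ae_notRoot] with x hx hroot
  exact hroot (by simpa using hx)

variable {g : ℕ} {α β : Fin g → ℝ} {i : Fin g} {K n : ℕ}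

/-- The orthogonality measure `w dx` on the bands. -/
noncomputable def bandMeasure (α β : Fin g → ℝ) : Measure ℝ :=
  (volume.restrict (bands α β)).withDensity fun x => ENNReal.ofReal (weight α β x)

/-- The numerator `∏ (z - αₗ)` of the squared Stieltjes transform of `w dx`. -/
noncomputable def numerator (α : Fin g → ℝ) : ℝ[X] := ∏ k, (X - C (α k))

/-- The denominator `(z² - 1) ∏ (z - βₗ)` of the squared Stieltjes transform of `w dx`. -/
noncomputable def denominator (β : Fin g → ℝ) : ℝ[X] :=
  (X - C 1) * ((X + C 1) * ∏ k, (X - C (β k)))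

lemma measurable_weight : Measurable (weight α β) := by
  unfold weight
  fun_prop

lemma weight_nonneg (x : ℝ) : 0 ≤ weight α β x :=
  mul_nonneg (by positivity) (Real.sqrt_nonneg _)

lemma integral_bandMeasure (f : ℝ → ℝ) :
    ∫ x, f x ∂bandMeasure α β = ∫ x in bands α β, weight α β x * f x := by
  rw [bandMeasure, integral_withDensity_eq_integral_toReal_smul
    measurable_weight.ennreal_ofReal (.of_forall fun x => ENNReal.ofReal_lt_top)]
  simp only [ENNReal.toReal_ofReal (weight_nonneg _), smul_eq_mul]

lemma isCompactCarrier_bandMeasure (α β : Fin g → ℝ) :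
    IsCompactCarrier (bandMeasure α β) (bands α β) where
  isCompact := isCompact_Icc.diff (isOpen_iUnion fun _ => isOpen_Ioo)
  ae_mem := (withDensity_absolutelyContinuous _ _).ae_le (ae_restrict_mem measurableSet_bands)

instance : NullSingletonClass (bandMeasure α β) where
  measure_singleton x :=
    ((withDensity_absolutelyContinuous _ _).trans Measure.restrict_le_self.absolutelyContinuous)
      (by simp)

lemma P_zero : P α β 0 = 1 := by
  rw [P]
  simp

lemma cauchyTransform_bandMeasure (z : ℝ) : cauchyTransform (bandMeasure α β) (P α β 0) z =
    ∫ x in bands α β, weight α β x * (z - x)⁻¹ := by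
  rw [cauchyTransform, integral_bandMeasure, P_zero]
  simp only [eval_one, one_mul]

lemma momentFunctional_bandMeasure_mul [IsFiniteMeasure (bandMeasure α β)] (p q : ℝ[X]) :
    (isCompactCarrier_bandMeasure α β).momentFunctional (p * q) = polyInner α β p q := by
  rw [IsCompactCarrier.momentFunctional_apply, integral_bandMeasure, polyInner]
  simp only [eval_mul, mul_comm (weight α β _)]

lemma isMonicOrthogonal_P [IsFiniteMeasure (bandMeasure α β)] (hne : bandMeasure α β ≠ 0) :
    IsMonicOrthogonal (isCompactCarrier_bandMeasure α β).momentFunctional (P α β) := by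
  refine isMonicOrthogonal_of_gramSchmidt (fun n => ?_) fun p hp =>
    IsCompactCarrier.momentFunctional_mul_self_ne_zero _ hne hp
  simp only [momentFunctional_bandMeasure_mul]
  rw [P]

lemma recA_add_one [IsFiniteMeasure (bandMeasure α β)] (n : ℕ) : recA α β (n + 1) =
    jacobiA (isCompactCarrier_bandMeasure α β).momentFunctional (P α β) n := by
  simp only [recA, jacobiA, sqNorm, h, momentFunctional_bandMeasure_mul, Nat.add_sub_cancel]

lemma recB_add_one [IsFiniteMeasure (bandMeasure α β)] (n : ℕ) : recB α β (n + 1) =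
    jacobiB (isCompactCarrier_bandMeasure α β).momentFunctional (P α β) n := by
  simp only [recB, jacobiB, sqNorm, h, momentFunctional_bandMeasure_mul, Nat.add_sub_cancel]

lemma HasPeriod.hasPeriodicJacobi [IsFiniteMeasure (bandMeasure α β)] (hper : HasPeriod α β K)
    (hK : 1 ≤ K) :
    HasPeriodicJacobi (isCompactCarrier_bandMeasure α β).momentFunctional (P α β) K where
  ne_zero := Nat.one_le_iff_ne_zero.1 hK
  periodic_jacobiB n := by
    rw [← recB_add_one, ← recB_add_one, add_right_comm]
    exact hper.1 (n + 1) (by omega)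
  periodic_jacobiA n := by
    dsimp only
    rw [← recA_add_one, ← recA_add_one, add_right_comm n K 1, add_right_comm (n + 1) K 1]
    exact hper.2 (n + 2) (by omega)

lemma eval_numerator (z : ℝ) : (numerator α).eval z = ∏ k, (z - α k) := by
  simp only [numerator, eval_prod, eval_sub, eval_X, eval_C]

lemma eval_denominator (z : ℝ) :
    (denominator β).eval z = (z - 1) * ((z + 1) * ∏ k, (z - β k)) := by
  simp only [denominator, eval_mul, eval_prod, eval_sub, eval_add, eval_X, eval_C]

lemma rootMultiplicity_numerator_mul_denominator_one (hα : ∀ i, α i < 1) (hβ : ∀ i, β i < 1) :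
    (numerator α * denominator β).rootMultiplicity 1 = 1 := by
  set q : ℝ[X] := numerator α * ((X + C 1) * ∏ k, (X - C (β k)))
  have hq : q.eval 1 ≠ 0 := by
    simp only [q, eval_mul, eval_numerator, eval_prod, eval_sub, eval_add, eval_X, eval_C]
    exact mul_ne_zero (prod_ne_zero_iff.2 fun k _ => (sub_pos.2 (hα k)).ne')
      (mul_ne_zero (by norm_num) (prod_ne_zero_iff.2 fun k _ => (sub_pos.2 (hβ k)).ne'))
  have hq0 : q ≠ 0 := fun h => hq (by rw [h, eval_zero])
  rw [denominator, mul_left_comm, rootMultiplicity_mul (mul_ne_zero (X_sub_C_ne_zero 1) hq0),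
    rootMultiplicity_X_sub_C_self, rootMultiplicity_eq_zero hq]

lemma cauchyTransform_bandMeasure_sq_mul_eval (hα : ∀ i, -1 < α i) (hαβ : ∀ i, α i ≤ β i)
    (hβ : ∀ i, β i < 1) (hord : ∀ i j, i < j → β i < α j) {z : ℝ} (hz : 1 < z) :
    cauchyTransform (bandMeasure α β) (P α β 0) z ^ 2 * (denominator β).eval z =
      (numerator α).eval z := by
  have hprod : ∏ k, (z - β k) ≠ 0 := prod_ne_zero_iff.2 fun k _ => by linarith [hβ k]
  have hsq : z ^ 2 - 1 ≠ 0 := by nlinarith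
  rw [cauchyTransform_bandMeasure,
    (integrableOn_weight_and_sq_integral hα hαβ hβ hord).2 z hz, eval_numerator, eval_denominator,
    ← mul_assoc (z - 1), show (z - 1) * (z + 1) = z ^ 2 - 1 by ring,
    div_mul_cancel₀ _ (mul_ne_zero hsq hprod)]

lemma bandMeasure_ne_zero (hα : ∀ i, -1 < α i) (hαβ : ∀ i, α i ≤ β i) (hβ : ∀ i, β i < 1)
    (hord : ∀ i j, i < j → β i < α j) : bandMeasure α β ≠ 0 := by
  intro h
  have hF := cauchyTransform_bandMeasure_sq_mul_eval hα hαβ hβ hord one_lt_two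
  rw [cauchyTransform, h, integral_zero_measure, zero_pow two_ne_zero, zero_mul,
    eval_numerator] at hF
  exact prod_ne_zero_iff.2 (fun k _ => by linarith [hαβ k, hβ k]) hF.symm

lemma Ioo_subset_bands_compl (i : Fin g) : Set.Ioo (α i) (β i) ⊆ (bands α β)ᶜ :=
  fun _ hx hband => hband.2 (Set.mem_iUnion.2 ⟨i, hx⟩)

lemma eval_numerator_right_ne_zero (hαβ : ∀ i, α i ≤ β i) (hord : ∀ i j, i < j → β i < α j)
    (hi : α i < β i) : (numerator α).eval (β i) ≠ 0 := by
  rw [eval_numerator]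
  refine prod_ne_zero_iff.2 fun k _ => sub_ne_zero.2 ?_
  rcases lt_trichotomy k i with hk | rfl | hk
  · exact ((hαβ k).trans_lt ((hord k i hk).trans hi)).ne'
  · exact hi.ne'
  · exact (hord i k hk).ne

lemma eval_denominator_left_ne_zero (hα : ∀ i, -1 < α i) (hαβ : ∀ i, α i ≤ β i)
    (hβ : ∀ i, β i < 1) (hord : ∀ i j, i < j → β i < α j) (hi : α i < β i) :
    (denominator β).eval (α i) ≠ 0 := by
  rw [eval_denominator]
  refine mul_ne_zero (by linarith [hβ i]) (mul_ne_zero (by linarith [hα i])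
    (prod_ne_zero_iff.2 fun k _ => sub_ne_zero.2 ?_))
  rcases lt_trichotomy k i with hk | rfl | hk
  · exact (hord k i hk).ne'
  · exact hi.ne
  · exact (hi.trans ((hord i k hk).trans_le (hαβ k))).ne

lemma exists_eval_P_add_period_eq_zero (hα : ∀ i, -1 < α i) (hαβ : ∀ i, α i ≤ β i)
    (hβ : ∀ i, β i < 1) (hord : ∀ i j, i < j → β i < α j) (hK : 1 ≤ K)
    (hper : HasPeriod α β K) (hzero : ∃ x ∈ Set.Ioo (α i) (β i), (P α β n).eval x = 0) :
    ∃ y ∈ Set.Ioo (α i) (β i), (P α β (n + K)).eval y = 0 := by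
  obtain ⟨x, hx, hPx⟩ := hzero
  have hi : α i < β i := hx.1.trans hx.2
  have : IsFiniteMeasure (bandMeasure α β) := isFiniteMeasure_withDensity_ofReal
    (integrableOn_weight_and_sq_integral hα hαβ hβ hord).1.2
  have hF : ∀ᶠ z in atTop, cauchyTransform (bandMeasure α β) (P α β 0) z ^ 2 *
      (denominator β).eval z = (numerator α).eval z :=
    (eventually_gt_atTop 1).mono fun _ => cauchyTransform_bandMeasure_sq_mul_eval hα hαβ hβ hord
  have H := isMonicOrthogonal_P (bandMeasure_ne_zero hα hαβ hβ hord)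
  refine H.exists_eval_add_period_eq_zero (hper.hasPeriodicJacobi hK) (x := 1) ?_ hF
    (Ioo_subset_bands_compl i) ?_ (eval_denominator_left_ne_zero hα hαβ hβ hord hi)
    (eval_numerator_right_ne_zero hαβ hord hi) ?_ hx hPx
  · rw [rootMultiplicity_numerator_mul_denominator_one (fun k => (hαβ k).trans_lt (hβ k)) hβ]
    exact odd_one
  · rw [eval_numerator, prod_eq_zero (mem_univ i) (sub_self _)]
  · rw [eval_denominator, prod_eq_zero (mem_univ i) (sub_self _), mul_zero, mul_zero]

end BandMeasure

end GenCheb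

theorem mainTheorem11 (g : ℕ) (α β : Fin g → ℝ)
    (hα : ∀ i, -1 < α i) (hαβ : ∀ i, α i ≤ β i) (hβ : ∀ i, β i < 1)
    (hord : ∀ i j, i < j → β i < α j)
    (K : ℕ) (hK : 1 ≤ K) (hper : GenCheb.HasPeriod α β K)
    (n j : ℕ) (i : Fin g)
    (hzero : ∃ x ∈ Set.Ioo (α i) (β i), (GenCheb.P α β j).eval x = 0) :
    ∃ y ∈ Set.Ioo (α i) (β i), (GenCheb.P α β (n * K + j)).eval y = 0 := by
  induction n with
  | zero => simpa using hzero
  | succ n ih =>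
    rw [show (n + 1) * K + j = n * K + j + K by ring]
    exact GenCheb.exists_eval_P_add_period_eq_zero hα hαβ hβ hord hK hper ih
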